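/- **Theorem (Performance for Optimization Problems).** *Model.* Time is slotted, $t\in\{0,1,2,\dots\}$. In each slot there is a random outcome $\Omega(t)=(\omega(t),\phi(t))$, i.i.d. over slots with a law that is independent of the past, where $\phi(t)\in\{0,1\}$ is independent of $\omega(t)$ and $\Pr[\phi(t)=1]=\phi\in(0,1]$. A controller that observes the past, the state $z(t)$ and $\Omega(t)$ chooses an action $I(t)\in\mathcal I_{\Omega(t),z(t)}$, possibly at random. The state lives in a countable set $\mathcal Z\ni 0$, starts at $z(0)=0$, and given the past, $z(t)$, $I(t)$ and $\Omega(t)$, moves to $z$ with probability $P_{z(t)z}(I(t),\Omega(t))$; if $\phi(t)=1$ then $z(t+1)=0$ (a forced renewal). For finite index sets $\mathcal N$ and $\mathcal M=\{1,\dots,M\}$, the quantities $\mu_n(t)\in[0,\mu_n^{max}]$, $R_n(t)\in[0,R_n^{max}]$ ($n\in\mathcal N$) and $x_m(t)\in[x_m^{min},x_m^{max}]$ ($0\le m\le M$) are functions of $(I(t),\Omega(t),z(t))$, and $d_n=\mu_n-R_n$. With all queues initially $0$, $$Q_n(t+1)=\max[Q_n(t)-\mu_n(t),0]+R_n(t),\qquad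 Y_m(t+1)=\max[Y_m(t)-x_m^{av}+x_m(t),0],$$ where the $x_m^{av}$ $(1\le m\le M)$ are given constants, and $\Theta(t)=(Q(t),Y(t))$. Write $\overline{f}=\limsup_{t\to\infty}\frac1t\sum_{\tau=0}^{t-1}\mathbb E[f(\tau)]$. The (type-2) renewal times are $t_0=0$ and $t_{g+1}=1+\min\{s\ge t_g:\phi(s)=1\}$, and $T_g=t_{g+1}-t_g$. *Benchmarks.* A $(z,\Omega)$-only policy draws $I(t)$ from a fixed distribution that depends only on $(z(t),\Omega(t))$. Quantities under such a policy carry a star, and $T^*$ is the length of its first renewal interval. Let $x_0^{opt}$ be the infimum of $\overline{x}_0^*$ over the $(z,\Omega)$-only policies with $\overline{x}_m^*\le x_m^{av}$ for all $m\in\mathcal M$ and $\overline{\mu}_n^*-\overline{R}_n^*\ge0$ for all $n\in\mathcal N$. *Assumption 1 (with slack $\epsilon>0$).* Some $(z,\Omega)$-only policy satisfies $\mathbb E[\sum_{\tau<T^*}x_m^*(\tau)]/\mathbb E[T^*]\le x_m^{av}-\epsilon$ and $\mathbb E[\sum_{\tau<T^*}d_n^*(\tau)]/\mathbb E[T^*]\ge\epsilon$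 for all $m\in\mathcal M$, $n\in\mathcal N$. *Assumption 2.* Some $(z,\Omega)$-only policy satisfies $\mathbb E[\sum_{\tau<T^*}x_0^*(\tau)]/\mathbb E[T^*]=x_0^{opt}$, $\mathbb E[\sum_{\tau<T^*}x_m^*(\tau)]/\mathbb E[T^*]\le x_m^{av}$ and $\mathbb E[\sum_{\tau<T^*}d_n^*(\tau)]/\mathbb E[T^*]\ge0$ for all $m\in\mathcal M$, $n\in\mathcal N$. *Algorithm.* For $V>0$ the drift-plus-penalty expression of the renewal interval starting at $t_g$ is $$-\sum_n Q_n(t_g)\,\mathbb E\Big[\sum_{\tau=0}^{T_g-1}d_n(t_g+\tau)\Big|\Theta(t_g)\Big]-\sum_m Y_m(t_g)\,\mathbb E\Big[T_gx_m^{av}-\sum_{\tau=0}^{T_g-1}x_m(t_g+\tau)\Big|\Theta(t_g)\Big]+V\,\mathbb E\Big[\sum_{\tau=0}^{T_g-1}x_0(t_g+\tau)\Big|\Theta(t_g)\Big].$$ Its optimal (weighted stochastic shortest path) value is the infimum, with the weights $\Theta(t_g)$ fixed, over all control policies for one renewal interval started in state $0$. Let $C,\delta\ge0$ be constants such that, for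 every $g$, the implemented policy makes this expression at most its optimal value plus $$C+\delta\sum_nQ_n(t_g)+\delta\sum_mY_m(t_g)+V\delta .$$ *Constant $B$.* Let $\sigma^2\ge\sum_n[\mu_n(t)^2+R_n(t)^2]+\sum_m(x_m(t)-x_m^{av})^2$ for all $t$, and let $B=\frac{\sigma^2}{2}\sup\mathbb E[T_g^2\mid\Theta(t_g)]$. *Claim.* If Assumptions 1 and 2 hold and $\epsilon>\phi\delta$, then $B\le\frac{(2-\phi)\sigma^2}{2\phi^2}$, and: 1. $\overline{Q}_n<\infty$ and $\overline{Y}_m<\infty$ for all $n\in\mathcal N$, $m\in\mathcal M$, and $\overline{x}_m\le x_m^{av}$ for all $m\in\mathcal M$. 2. For every positive integer $G$, $$\frac1G\sum_{g=0}^{G-1}\Big[\sum_n\mathbb E[Q_n(t_g)]+\sum_m\mathbb E[Y_m(t_g)]\Big]\le\frac{(B+C)\phi+V(\phi\delta+x_0^{max}-x_0^{min})}{\epsilon-\phi\delta},$$ with all these expectations finite. 3. The time average penalty satisfies $$\limsup_{t\to\infty}\frac1t\sum_{\tau=0}^{t-1}\mathbb E[x_0(\tau)]\le x_0^{opt}+\frac{(B+C)\phi}{V}+\phi\delta\Big[1+\frac{x_0^{max}-x_0^{opt}}{\epsilon}\Big].$$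 4. For every positive integer $G$, $\mathbb E[t_G]=G/\phi$, and $\mathbb E\big[\sum_{\tau=0}^{t_G-1}x_0(\tau)\big]/\mathbb E[t_G]$ is at most the right-hand side in 3. -/

import Mathlib

open MeasureTheory ProbabilityTheory Filter

universe u v

/-- A slotted-time queueing network with a controlled Markov state and forced renewals.
`N` indexes the queues, `M` the constrained penalties (the objective penalty is separate),
`W` is the set of outcomes `ω(t)`, `Z` the countable set of states, `A` the set of actions.
The random outcome of a slot is `Ω = (ω, b) : W × Bool`, where `b = true` is a forced renewal. -/
structure RenewalNetwork (N M : Type*) (W Z A : Type u)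
    [MeasurableSpace W] [MeasurableSpace Z] [MeasurableSpace A] where
  /-- the law of `ω(t)` -/
  law : Measure W
  law_prob : IsProbabilityMeasure law
  /-- the forced renewal probability -/
  phi : ℝ
  phi_pos : 0 < phi
  phi_le_one : phi ≤ 1
  /-- the renewal state `0` -/
  zero : Z
  /-- the actions that are allowed under the outcome `Ω` in the state `z` -/
  actions : W × Bool → Z → Set A
  /-- the transition probabilities: the law of the next state, given state, action, outcome -/
  trans : Kernel (Z × A × (W × Bool)) Z
  trans_markov : IsMarkovKernel trans
  /-- a forced renewal sends the state to `0` -/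
  trans_forced : ∀ w z, ∀ a ∈ actions (w, true) z,
    trans (z, a, (w, true)) = Measure.dirac zero
  /-- the service rates `μ_n`, arrivals `R_n`, objective penalty `x_0`, penalties `x_m` -/
  serv : N → A × (W × Bool) × Z → ℝ
  arr : N → A × (W × Bool) × Z → ℝ
  pen0 : A × (W × Bool) × Z → ℝ
  pen : M → A × (W × Bool) × Z → ℝ
  serv_meas : ∀ n, Measurable (serv n)
  arr_meas : ∀ n, Measurable (arr n)
  pen0_meas : Measurable pen0
  pen_meas : ∀ m, Measurable (pen m)
  servMax : N → ℝ
  arrMax : N → ℝ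
  pen0Min : ℝ
  pen0Max : ℝ
  penMin : M → ℝ
  penMax : M → ℝ
  serv_bdd : ∀ n o z, ∀ a ∈ actions o z, 0 ≤ serv n (a, o, z) ∧ serv n (a, o, z) ≤ servMax n
  arr_bdd : ∀ n o z, ∀ a ∈ actions o z, 0 ≤ arr n (a, o, z) ∧ arr n (a, o, z) ≤ arrMax n
  pen0_bdd : ∀ o z, ∀ a ∈ actions o z, pen0Min ≤ pen0 (a, o, z) ∧ pen0 (a, o, z) ≤ pen0Max
  pen_bdd : ∀ m o z, ∀ a ∈ actions o z,
    penMin m ≤ pen m (a, o, z) ∧ pen m (a, o, z) ≤ penMax m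
  /-- the required bounds `x_m^av` on the time averages of the penalties -/
  penAv : M → ℝ

namespace RenewalNetwork

variable {N M : Type*} {W Z A : Type u}
  [MeasurableSpace W] [MeasurableSpace Z] [MeasurableSpace A]

/-- The law of `Ω(t) = (ω(t), φ(t))`: `φ(t)` is Bernoulli with parameter `phi`,
independent of `ω(t)`. -/
noncomputable def outcomeLaw (net : RenewalNetwork N M W Z A) : Measure (W × Bool) :=
  net.law.prod (ENNReal.ofReal net.phi • Measure.dirac true
    + ENNReal.ofReal (1 - net.phi) • Measure.dirac false)

/-- The network run under some (possibly randomized, possibly history dependent, non-anticipating)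
control policy, on a probability space `(S, P)`. The sigma-algebra `hist t` is the information
before `Ω(t)` is observed; it contains `z(0), …, z(t)`, all earlier outcomes and actions, and
whatever private randomization the controller has used so far. -/
structure Run (net : RenewalNetwork N M W Z A) {S : Type v} [mS : MeasurableSpace S]
    (P : Measure S) where
  hist : Filtration ℕ mS
  /-- `z(t)` -/
  state : ℕ → S → Z
  /-- `Ω(t)` -/
  out : ℕ → S → W × Bool
  /-- `I(t)` -/
  act : ℕ → S → A
  state_meas : ∀ t, Measurable[hist t] (state t)
  out_meas : ∀ t, Measurable[hist (t + 1)] (out t)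
  act_meas : ∀ t, Measurable[hist (t + 1)] (act t)
  state_zero : ∀ s, state 0 s = net.zero
  /-- `Ω(t)` has the prescribed law and is independent of the past -/
  out_law : ∀ t, P.map (out t) = net.outcomeLaw
  out_indep : ∀ t, Indep (hist t) (MeasurableSpace.comap (out t) inferInstance) P
  act_mem : ∀ t, ∀ᵐ s ∂P, act t s ∈ net.actions (out t s) (state t s)
  /-- given the past, `Ω(t)` and `I(t)`, the next state has the law `trans (z(t), I(t), Ω(t))` -/
  state_step : ∀ t (B : Set Z), MeasurableSet B →
    P⟦state (t + 1) ⁻¹' B | hist t ⊔ MeasurableSpace.comap (out t) inferInstance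
        ⊔ MeasurableSpace.comap (act t) inferInstance⟧
      =ᵐ[P] fun s => (net.trans (state t s, act t s, out t s)).real B

namespace Run

variable {net : RenewalNetwork N M W Z A} {S : Type v} [MeasurableSpace S] {P : Measure S}

/-- The run follows a `(z, Ω)`-only policy: the action is drawn from a fixed probability
distribution that depends only on the current state and outcome. -/
def IsStateOutcomeOnly (X : net.Run P) : Prop :=
  ∃ π : Kernel (Z × (W × Bool)) A, IsMarkovKernel π ∧
    ∀ t (B : Set A), MeasurableSet B →
      P⟦X.act t ⁻¹' B | X.hist t ⊔ MeasurableSpace.comap (X.out t) inferInstance⟧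
        =ᵐ[P] fun s => (π (X.state t s, X.out t s)).real B

/-- The value on slot `t` of a function of action, outcome and state. -/
def eval (X : net.Run P) (f : A × (W × Bool) × Z → ℝ) (t : ℕ) (s : S) : ℝ :=
  f (X.act t s, X.out t s, X.state t s)

/-- The actual queues `Q_n(t)`, initially empty. -/
noncomputable def Q (X : net.Run P) (n : N) : ℕ → S → ℝ
  | 0, _ => 0
  | t + 1, s => max (X.Q n t s - X.eval (net.serv n) t s) 0 + X.eval (net.arr n) t s

/-- The virtual queues `Y_m(t)`, initially empty. -/
noncomputable def Y (X : net.Run P) (m : M) : ℕ → S → ℝ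
  | 0, _ => 0
  | t + 1, s => max (X.Y m t s - net.penAv m + X.eval (net.pen m) t s) 0

/-- The time from slot `t` until the first type-2 renewal after `t`: the renewal takes place
right after the first slot `t + k`, `k ≥ 0`, whose outcome is a forced renewal. -/
noncomputable def timeToRenewal (X : net.Run P) (t : ℕ) (s : S) : ℕ :=
  sInf {k : ℕ | (X.out (t + k) s).2 = true} + 1

/-- The type-2 renewal times `t_g`, with `t_0 = 0`. -/
noncomputable def renewalTime (X : net.Run P) : ℕ → S → ℕ
  | 0, _ => 0
  | g + 1, s => X.renewalTime g s + X.timeToRenewal (X.renewalTime g s) s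

/-- The length `T_g` of the renewal interval that starts at `t_g`. -/
noncomputable def frameLength (X : net.Run P) (g : ℕ) (s : S) : ℕ :=
  X.timeToRenewal (X.renewalTime g s) s

/-- The sum of `f` over the slots of the renewal interval that starts at `t_g`. -/
noncomputable def frameSum (X : net.Run P) (f : A × (W × Bool) × Z → ℝ) (g : ℕ) (s : S) : ℝ :=
  ∑ τ ∈ Finset.range (X.frameLength g s), X.eval f (X.renewalTime g s + τ) s

/-- The queue vector `Θ(t_g)`, with its real and its virtual part. -/
noncomputable def Theta (X : net.Run P) (g : ℕ) (s : S) : (N → ℝ) × (M → ℝ) :=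
  (fun n => X.Q n (X.renewalTime g s) s, fun m => X.Y m (X.renewalTime g s) s)

/-- The sigma-algebra generated by `Θ(t_g)`. -/
noncomputable abbrev sigmaTheta (X : net.Run P) (g : ℕ) : MeasurableSpace S :=
  MeasurableSpace.comap (X.Theta g) inferInstance

/-- The time average `limsup (1/t) ∑_{τ < t} E[f(τ)]` of a bounded penalty or rate. -/
noncomputable def timeAvg (X : net.Run P) (f : A × (W × Bool) × Z → ℝ) : ℝ :=
  limsup (fun t : ℕ => (∑ τ ∈ Finset.range t, ∫ s, X.eval f τ s ∂P) / t) atTop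

/-- The ratio `E[∑_{τ < T} f(τ)] / E[T]` over the first renewal interval. -/
noncomputable def frameRatio (X : net.Run P) (f : A × (W × Bool) × Z → ℝ) : ℝ :=
  (∫ s, X.frameSum f 0 s ∂P) / (∫ s, (X.frameLength 0 s : ℝ) ∂P)

/-- The drift-plus-penalty expression at the renewal time `t_g`, given `Θ(t_g)`:
`-∑ Q_n E[∑ d_n | Θ] - ∑ Y_m E[T x_m^av - ∑ x_m | Θ] + V E[∑ x_0 | Θ]`, `d_n = μ_n - R_n`. -/
noncomputable def driftPlusPenalty [Fintype N] [Fintype M] (X : net.Run P) (V : ℝ)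
    (g : ℕ) (s : S) : ℝ :=
  -(∑ n, (X.Theta g s).1 n *
      (P[X.frameSum (fun p => net.serv n p - net.arr n p) g | X.sigmaTheta g]) s)
  - (∑ m, (X.Theta g s).2 m *
      (P[fun s' => X.frameLength g s' * net.penAv m - X.frameSum (net.pen m) g s'
          | X.sigmaTheta g]) s)
  + V * (P[X.frameSum net.pen0 g | X.sigmaTheta g]) s

/-- The drift-plus-penalty expression of the first renewal interval when the queue weights are
frozen at `θ`. -/
noncomputable def weightedCost [Fintype N] [Fintype M] (X : net.Run P) (V : ℝ)
    (θ : (N → ℝ) × (M → ℝ)) : ℝ :=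
  -(∑ n, θ.1 n * (∫ s, X.frameSum (fun p => net.serv n p - net.arr n p) 0 s ∂P))
  - (∑ m, θ.2 m * (∫ s, (X.frameLength 0 s * net.penAv m - X.frameSum (net.pen m) 0 s) ∂P))
  + V * ∫ s, X.frameSum net.pen0 0 s ∂P

/-- The constant `B = (σ² / 2) sup E[T² | Θ(t_g)]`. -/
noncomputable def driftConst (X : net.Run P) (sigmaSq : ℝ) : ℝ :=
  sigmaSq / 2 *
    ⨆ g : ℕ, essSup (P[fun s => (X.frameLength g s : ℝ) ^ 2 | X.sigmaTheta g]) P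

end Run

/-- The optimal value of the weighted stochastic shortest path problem with queue weights `θ`:
the infimum of the drift-plus-penalty expression over all control policies for one renewal
interval that starts in the state `0`. -/
noncomputable def sspValue [Fintype N] [Fintype M] (net : RenewalNetwork N M W Z A) (V : ℝ)
    (θ : (N → ℝ) × (M → ℝ)) : ℝ :=
  sInf {v | ∃ (S : Type u) (_ : MeasurableSpace S) (P : Measure S) (_ : IsProbabilityMeasure P)
    (X : net.Run P), v = X.weightedCost V θ}

/-- `x_0^opt`: the infimum of the time average of `x_0` over the `(z, Ω)`-only policies that
satisfy the time average constraints. -/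
noncomputable def optValue (net : RenewalNetwork N M W Z A) : ℝ :=
  sInf {v | ∃ (S : Type u) (_ : MeasurableSpace S) (P : Measure S) (_ : IsProbabilityMeasure P)
    (X : net.Run P), X.IsStateOutcomeOnly ∧
      (∀ m, X.timeAvg (net.pen m) ≤ net.penAv m) ∧
      (∀ n, 0 ≤ X.timeAvg (net.serv n) - X.timeAvg (net.arr n)) ∧
      v = X.timeAvg net.pen0}

/-- Slackness of feasibility with slack `ε`. -/
def Slackness (net : RenewalNetwork N M W Z A) (ε : ℝ) : Prop :=
  ∃ (S : Type u) (_ : MeasurableSpace S) (P : Measure S) (_ : IsProbabilityMeasure P)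
    (X : net.Run P), X.IsStateOutcomeOnly ∧
      (∀ m, X.frameRatio (net.pen m) ≤ net.penAv m - ε) ∧
      (∀ n, ε ≤ X.frameRatio (fun p => net.serv n p - net.arr n p))

/-- The optimum is attained by a feasible `(z, Ω)`-only policy. -/
def OptimumAttained (net : RenewalNetwork N M W Z A) : Prop :=
  ∃ (S : Type u) (_ : MeasurableSpace S) (P : Measure S) (_ : IsProbabilityMeasure P)
    (X : net.Run P), X.IsStateOutcomeOnly ∧
      X.frameRatio net.pen0 = net.optValue ∧
      (∀ m, X.frameRatio (net.pen m) ≤ net.penAv m) ∧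
      (∀ n, 0 ≤ X.frameRatio (fun p => net.serv n p - net.arr n p))

end RenewalNetwork

/-- `limsup (1/t) ∑_{τ < t} E[q(τ)]` for a nonnegative backlog process `q`, with values in
`[0, ∞]`. -/
noncomputable def avgBacklog {S : Type*} [MeasurableSpace S] (P : Measure S)
    (q : ℕ → S → ℝ) : ENNReal :=
  limsup (fun t : ℕ =>
    (∑ τ ∈ Finset.range t, ∫⁻ s, ENNReal.ofReal (q τ s) ∂P) / (t : ENNReal)) atTop

/-! ### Renewal times: stopping property, geometric lengths, independence of the past, moments. -/

section RenewalTimes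

namespace RenewalNetwork

variable {N M : Type*} {W Z A : Type u}
  [MeasurableSpace W] [MeasurableSpace Z] [MeasurableSpace A]

/-! The proof is a Lyapunov drift argument carried out over renewal intervals rather than slots.
Forced renewals are coin flips independent of the past, so whatever the controller does, an interval
length is geometric and independent of everything known at its start (`indepFun_frameLength`). Hence
`E[T] = 1/φ` and `E[T²] = (2 - φ)/φ²`, also conditionally on `Θ(t_g)`, and `B` is an explicit number
(`driftConst_eq`).

With `L = ½ ∑ q²` over all actual and virtual queues, one interval raises `E[L]` by at most `B` plus
the expected sum of queue times net input (`sq_le_of_step`, `meanLyapunov_succ_le`). Adding `V`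
times the penalty produces the expectation of the drift-plus-penalty expression. The algorithm
nearly minimizes it, and with frozen weights the optimal value is at most the cost of any competing
run, whose expected interval sums are constants. This gives `meanLyapunov_add_penalty_le`.

Two competitors are inserted. The slack policy contributes `-(ε/φ)` times the mean backlog, at the
price of a penalty of at most `x_0^max`; telescoping bounds the average backlog. The optimal policy
contributes the penalty `x_0^opt` but leaves the error `δ` times the backlog. Weighting the slack
inequality by `φδ/ε` and the optimal one by `1 - φδ/ε` cancels the backlog exactly, and telescoping
(`mul_sum_le_of_drift`) yields the penalty bound with its stated constant.

Passing from intervals to slots uses a deterministic number `⌈φt⌉` of intervals: the variance of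
`t_G` grows at most linearly, so the expected distance from `t` to the corresponding renewal time is
`O(√t)`. Bounded penalties therefore have slot averages controlled by interval averages
(`timeAvg_le_of_frame_bound`). The penalty constraints follow from `E[Y_m] = O(√t)`
(`timeAvg_pen_le`), and strong stability from queues being Lipschitz in time
(`avgBacklog_queue_lt_top`). -/

theorem outcomeLaw_forced (net : RenewalNetwork N M W Z A) :
    net.outcomeLaw (Prod.snd ⁻¹' {true}) = ENNReal.ofReal net.phi := by
  have := net.law_prob
  have h : (Prod.snd ⁻¹' {true} : Set (W × Bool)) = Set.univ ×ˢ {true} := by ext; simp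
  rw [outcomeLaw, h, Measure.prod_prod]
  simp

theorem outcomeLaw_unforced (net : RenewalNetwork N M W Z A) :
    net.outcomeLaw (Prod.snd ⁻¹' {false}) = ENNReal.ofReal (1 - net.phi) := by
  have := net.law_prob
  have h : (Prod.snd ⁻¹' {false} : Set (W × Bool)) = Set.univ ×ˢ {false} := by ext; simp
  rw [outcomeLaw, h, Measure.prod_prod]
  simp

namespace Run

variable {net : RenewalNetwork N M W Z A} {S : Type v} [mS : MeasurableSpace S] {P : Measure S}

theorem measurableSet_forced (X : net.Run P) (t : ℕ) (b : Bool) :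
    MeasurableSet[X.hist (t + 1)] {s | (X.out t s).2 = b} :=
  X.out_meas t (measurable_snd (measurableSet_singleton b))

theorem measurable_out (X : net.Run P) (t : ℕ) : Measurable (X.out t) :=
  (X.out_meas t).mono (X.hist.le _) le_rfl

theorem measure_inter_forced (X : net.Run P) {t : ℕ} {D : Set S}
    (hD : MeasurableSet[X.hist t] D) (b : Bool) :
    P (D ∩ {s | (X.out t s).2 = b}) = P D * net.outcomeLaw (Prod.snd ⁻¹' {b}) := by
  have hb : MeasurableSet (Prod.snd ⁻¹' {b} : Set (W × Bool)) :=
    measurable_snd (measurableSet_singleton b)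
  rw [← X.out_law t, Measure.map_apply (X.measurable_out t) hb]
  exact (Indep_iff _ _ _).1 (X.out_indep t) D _ hD ⟨_, hb, rfl⟩

/-- No forced renewal takes place in the slots `i, …, i + k - 1`. -/
def noRenewal (X : net.Run P) (i k : ℕ) : Set S :=
  {s | ∀ j < k, (X.out (i + j) s).2 = false}

/-- The first forced renewal after the beginning of slot `i` takes place in slot `i + k`. -/
def firstRenewal (X : net.Run P) (i k : ℕ) : Set S :=
  X.noRenewal i k ∩ {s | (X.out (i + k) s).2 = true}

theorem noRenewal_zero (X : net.Run P) (i : ℕ) : X.noRenewal i 0 = Set.univ := by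
  simp [noRenewal]

theorem noRenewal_succ (X : net.Run P) (i k : ℕ) :
    X.noRenewal i (k + 1) = X.noRenewal i k ∩ {s | (X.out (i + k) s).2 = false} := by
  ext s
  exact Nat.forall_lt_succ_right

theorem measurableSet_noRenewal (X : net.Run P) (i k : ℕ) :
    MeasurableSet[X.hist (i + k)] (X.noRenewal i k) := by
  induction k with
  | zero => rw [noRenewal_zero]; exact MeasurableSet.univ
  | succ k ih =>
    rw [noRenewal_succ]
    exact (X.hist.mono (Nat.le_succ _) _ ih).inter (X.measurableSet_forced (i + k) false)

theorem measurableSet_firstRenewal (X : net.Run P) (i k : ℕ) :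
    MeasurableSet[X.hist (i + k + 1)] (X.firstRenewal i k) :=
  (X.hist.mono (Nat.le_succ _) _ (X.measurableSet_noRenewal i k)).inter
    (X.measurableSet_forced (i + k) true)

/-- Each further slot is independent of the history, which already contains `D` and the absence of
earlier renewals, so it contributes one more factor. -/
theorem measure_inter_noRenewal (X : net.Run P) {i : ℕ} {D : Set S}
    (hD : MeasurableSet[X.hist i] D) (k : ℕ) :
    P (D ∩ X.noRenewal i k) = P D * ENNReal.ofReal (1 - net.phi) ^ k := by
  induction k with
  | zero => simp [noRenewal_zero]
  | succ k ih =>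
    rw [noRenewal_succ, ← Set.inter_assoc, X.measure_inter_forced, ih, outcomeLaw_unforced,
      pow_succ, mul_assoc]
    exact (X.hist.mono (Nat.le_add_right _ _) _ hD).inter (X.measurableSet_noRenewal i k)

theorem measure_inter_firstRenewal (X : net.Run P) {i : ℕ} {D : Set S}
    (hD : MeasurableSet[X.hist i] D) (k : ℕ) :
    P (D ∩ X.firstRenewal i k)
      = P D * (ENNReal.ofReal (1 - net.phi) ^ k * ENNReal.ofReal net.phi) := by
  rw [firstRenewal, ← Set.inter_assoc, X.measure_inter_forced, X.measure_inter_noRenewal hD,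
    outcomeLaw_forced, mul_assoc]
  exact (X.hist.mono (Nat.le_add_right _ _) _ hD).inter (X.measurableSet_noRenewal i k)

/-- This discards the event on which `sInf ∅ = 0` makes `timeToRenewal` equal to 1 without any
renewal. Deciding whether that event occurs requires the entire future, which is why the stopping
time property below holds only up to null sets. -/
theorem ae_exists_forced [IsProbabilityMeasure P] (X : net.Run P) :
    ∀ᵐ s ∂P, ∀ i, ∃ k, (X.out (i + k) s).2 = true := by
  rw [ae_all_iff]
  intro i
  have hlim : Tendsto (fun k : ℕ => ENNReal.ofReal (1 - net.phi) ^ k) atTop (nhds 0) := by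
    apply ENNReal.tendsto_pow_atTop_nhds_zero_of_lt_one
    rw [ENNReal.ofReal_lt_one]
    linarith [net.phi_pos]
  rw [ae_iff]
  refine le_antisymm (ge_of_tendsto' hlim fun k => ?_) zero_le
  have h := X.measure_inter_noRenewal (i := i) MeasurableSet.univ k
  rw [measure_univ, one_mul, Set.univ_inter] at h
  rw [← h]
  refine measure_mono fun s hs j _ => ?_
  simp only [not_exists, Set.mem_ofPred_eq, Bool.not_eq_true] at hs
  exact hs j

theorem timeToRenewal_eq_iff (X : net.Run P) {i k : ℕ} {s : S}
    (hs : ∃ k, (X.out (i + k) s).2 = true) :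
    X.timeToRenewal i s = k + 1 ↔ s ∈ X.firstRenewal i k := by
  have hne : {k : ℕ | (X.out (i + k) s).2 = true}.Nonempty := hs
  rw [timeToRenewal, Nat.add_right_cancel_iff]
  constructor
  · rintro rfl
    refine ⟨fun j hj => ?_, Nat.sInf_mem hne⟩
    simpa using Nat.notMem_of_lt_sInf hj
  · rintro ⟨h1, h2⟩
    refine le_antisymm (Nat.sInf_le h2) (le_of_not_gt fun hlt => ?_)
    have := h1 _ hlt
    rw [show (X.out (i + sInf {k : ℕ | (X.out (i + k) s).2 = true}) s).2 = true from
      Nat.sInf_mem hne] at this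
    exact absurd this (by simp)

theorem timeToRenewal_pos (X : net.Run P) (i : ℕ) (s : S) : 0 < X.timeToRenewal i s :=
  Nat.succ_pos _

theorem measurable_timeToRenewal (X : net.Run P) (i : ℕ) : Measurable (X.timeToRenewal i) := by
  have hm : ∀ k b, MeasurableSet {s | (X.out (i + k) s).2 = b} := fun k b =>
    X.hist.le _ _ (X.measurableSet_forced (i + k) b)
  have hF : ∀ k, MeasurableSet (X.firstRenewal i k) := fun k =>
    X.hist.le _ _ (X.measurableSet_firstRenewal i k)
  have hE : MeasurableSet {s | ∃ k, (X.out (i + k) s).2 = true} := by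
    rw [Set.ofPred_exists]
    exact MeasurableSet.iUnion fun k => hm k true
  refine measurable_to_countable' fun n => ?_
  cases n with
  | zero =>
    convert MeasurableSet.empty
    ext s
    simp [timeToRenewal]
  | succ k =>
    -- The second piece of the union is the default value 1 of `timeToRenewal` when no renewal ever
    -- follows; it contributes only for `k = 0`.
    have : X.timeToRenewal i ⁻¹' {k + 1}
        = {s | ∃ k, (X.out (i + k) s).2 = true} ∩ X.firstRenewal i k
          ∪ {s | ∃ k, (X.out (i + k) s).2 = true}ᶜ ∩ {_s | k = 0} := by
      ext s
      by_cases hs : ∃ k, (X.out (i + k) s).2 = true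
      · have := X.timeToRenewal_eq_iff (k := k) hs
        simp_all
      · have h0 : {k : ℕ | (X.out (i + k) s).2 = true} = ∅ := by
          ext k; simpa using fun h => hs ⟨k, h⟩
        have : X.timeToRenewal i s = 1 := by simp [timeToRenewal, h0]
        simp only [Set.mem_preimage, this, Set.mem_singleton_iff, Set.mem_union, Set.mem_inter_iff,
          Set.mem_ofPred_eq, hs, Set.mem_compl_iff]
        simp
    rw [this]
    exact (hE.inter (hF k)).union (hE.compl.inter (MeasurableSet.const _))

theorem measurable_comp_random {β : Type*} [MeasurableSpace β] {F : ℕ → S → β} {τ : S → ℕ}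
    (hF : ∀ i, Measurable (F i)) (hτ : Measurable τ) : Measurable fun s => F (τ s) s := by
  have h : Measurable fun p : ℕ × S => F p.1 p.2 := measurable_from_prod_countable_right hF
  exact h.comp (hτ.prodMk measurable_id)

theorem measurable_renewalTime (X : net.Run P) (g : ℕ) : Measurable (X.renewalTime g) := by
  induction g with
  | zero => exact measurable_const
  | succ g ih => exact ih.add (measurable_comp_random (F := X.timeToRenewal) X.measurable_timeToRenewal ih)

theorem measurable_frameLength (X : net.Run P) (g : ℕ) : Measurable (X.frameLength g) :=
  measurable_comp_random (F := X.timeToRenewal) X.measurable_timeToRenewal (X.measurable_renewalTime g)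

theorem frameLength_pos (X : net.Run P) (g : ℕ) (s : S) : 0 < X.frameLength g s :=
  X.timeToRenewal_pos _ s

theorem renewalTime_succ (X : net.Run P) (g : ℕ) (s : S) :
    X.renewalTime (g + 1) s = X.renewalTime g s + X.frameLength g s := rfl

/-- Up to null sets the renewal times are stopping times. -/
theorem exists_renewalTime_ae_eq [IsProbabilityMeasure P] (X : net.Run P) (g i : ℕ) :
    ∃ E, MeasurableSet[X.hist i] E ∧ {s | X.renewalTime g s = i} =ᵐ[P] E := by
  induction g generalizing i with
  | zero => exact ⟨{_s | 0 = i}, MeasurableSet.const _, by rfl⟩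
  | succ g ih =>
    choose E hE hE' using ih
    -- An interval ends at `i` when it started at some `j < i` and its first forced slot is `i - 1`,
    -- at offset `i - j - 1` from `j`.
    refine ⟨⋃ j ∈ {j | j < i}, E j ∩ X.firstRenewal j (i - j - 1), ?_, ?_⟩
    · refine MeasurableSet.biUnion (Set.to_countable _) fun j hj => ?_
      have hj' : j + (i - j - 1) + 1 = i := by simp only [Set.mem_ofPred_eq] at hj; omega
      have := X.measurableSet_firstRenewal j (i - j - 1)
      rw [hj'] at this
      exact (X.hist.mono (le_of_lt hj) _ (hE j)).inter this
    · have hE'' := ae_all_iff.2 fun j => (hE' j).mem_iff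
      filter_upwards [hE'', X.ae_exists_forced] with s hs hex
      refine propext ?_
      change X.renewalTime (g + 1) s = i ↔ s ∈ ⋃ j ∈ {j | j < i}, E j ∩ _
      simp only [Set.mem_iUnion, Set.mem_inter_iff, ← hs, Set.mem_ofPred_eq, exists_prop]
      constructor
      · rintro rfl
        refine ⟨_, ?_, rfl, ?_⟩
        · rw [renewalTime_succ]
          have := X.frameLength_pos g s
          omega
        · rw [← X.timeToRenewal_eq_iff (hex _), renewalTime_succ]
          have := X.frameLength_pos g s
          change X.frameLength g s = _
          omega
      · rintro ⟨j, hj, rfl, h⟩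
        rw [← X.timeToRenewal_eq_iff (hex _)] at h
        rw [renewalTime_succ]
        change X.frameLength g s = _ at h
        omega

/-- The probabilities of the geometric law of the renewal intervals. -/
noncomputable def geomWeight (net : RenewalNetwork N M W Z A) : ℕ → ENNReal
  | 0 => 0
  | k + 1 => ENNReal.ofReal (1 - net.phi) ^ k * ENNReal.ofReal net.phi

theorem measure_inter_timeToRenewal [IsProbabilityMeasure P] (X : net.Run P) {i : ℕ} {D : Set S}
    (hD : MeasurableSet[X.hist i] D) (T : Set ℕ) :
    P (D ∩ {s | X.timeToRenewal i s ∈ T}) = P D * ∑' k : T, geomWeight net k := by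
  have hDm : MeasurableSet D := X.hist.le _ _ hD
  have hsingle : ∀ k, P (D ∩ X.timeToRenewal i ⁻¹' {k}) = P D * geomWeight net k := by
    intro k
    cases k with
    | zero =>
      have : X.timeToRenewal i ⁻¹' {0} = ∅ := by ext s; simp [timeToRenewal]
      simp [this, geomWeight]
    | succ k =>
      rw [geomWeight, ← X.measure_inter_firstRenewal hD]
      refine measure_congr ?_
      filter_upwards [X.ae_exists_forced] with s hex
      have := X.timeToRenewal_eq_iff (k := k) (hex i)
      exact propext (and_congr_right fun _ => this)
  have hU : D ∩ {s | X.timeToRenewal i s ∈ T} = ⋃ k : T, D ∩ X.timeToRenewal i ⁻¹' {(k : ℕ)} := by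
    ext s; simp
  rw [hU, measure_iUnion]
  · simp_rw [hsingle, ENNReal.tsum_mul_left]
  · intro a b hab
    refine Set.disjoint_left.2 fun s ha hb => hab (Subtype.ext ?_)
    exact ha.2.symm.trans hb.2
  · exact fun k => hDm.inter (X.measurable_timeToRenewal i (measurableSet_singleton _))

/-- A strong Markov argument: splitting over the values `i` of `t_g`, the event `t_g = i` is almost
surely in `hist i`, so the result for the deterministic start `i` applies to each piece. The family
`D i` expresses an event known at the random time `t_g`. -/
theorem measure_inter_frameLength [IsProbabilityMeasure P] (X : net.Run P) (g : ℕ)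
    {D : ℕ → Set S} (hD : ∀ i, MeasurableSet[X.hist i] (D i)) (T : Set ℕ) :
    P ({s | s ∈ D (X.renewalTime g s)} ∩ X.frameLength g ⁻¹' T)
      = P {s | s ∈ D (X.renewalTime g s)} * ∑' k : T, geomWeight net k := by
  choose E hE hE' using X.exists_renewalTime_ae_eq g
  have hDm : MeasurableSet {s | s ∈ D (X.renewalTime g s)} := by
    have : Measurable fun s => (s ∈ D (X.renewalTime g s)) :=
      measurable_comp_random (F := fun i s => s ∈ D i)
        (fun i => measurableSet_setOfPred.1 (X.hist.le _ _ (hD i))) (X.measurable_renewalTime g)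
    exact measurableSet_setOfPred.2 this
  have hsplit : ∀ B : Set S, MeasurableSet B →
      P B = ∑' i, P (B ∩ X.renewalTime g ⁻¹' {i}) := by
    intro B hB
    rw [← measure_iUnion]
    · congr 1; ext s; simp
    · intro a b hab
      exact Set.disjoint_left.2 fun s ha hb => hab (ha.2.symm.trans hb.2)
    · exact fun k => hB.inter (X.measurable_renewalTime g (measurableSet_singleton _))
  rw [hsplit _ (hDm.inter (X.measurable_frameLength g (MeasurableSet.of_discrete))),
    hsplit _ hDm, ← ENNReal.tsum_mul_right]
  refine tsum_congr fun i => ?_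
  have h1 : P ({s | s ∈ D (X.renewalTime g s)} ∩ X.renewalTime g ⁻¹' {i}) = P (D i ∩ E i) := by
    refine measure_congr ?_
    filter_upwards [(hE' i).mem_iff] with s hs
    refine propext ?_
    change s ∈ D (X.renewalTime g s) ∧ X.renewalTime g s = i ↔ s ∈ D i ∧ s ∈ E i
    rw [← hs]
    refine and_congr_left ?_
    rintro (h : X.renewalTime g s = i)
    rw [h]
  have h2 : P ({s | s ∈ D (X.renewalTime g s)} ∩ X.frameLength g ⁻¹' T
      ∩ X.renewalTime g ⁻¹' {i}) = P (D i ∩ E i ∩ {s | X.timeToRenewal i s ∈ T}) := by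
    refine measure_congr ?_
    filter_upwards [(hE' i).mem_iff] with s hs
    refine propext ?_
    change (s ∈ D (X.renewalTime g s) ∧ X.timeToRenewal (X.renewalTime g s) s ∈ T)
      ∧ X.renewalTime g s = i ↔ (s ∈ D i ∧ s ∈ E i) ∧ X.timeToRenewal i s ∈ T
    rw [← hs]
    constructor
    · rintro ⟨⟨h, h'⟩, h''⟩
      rw [h''] at h h'
      exact ⟨⟨h, h''⟩, h'⟩
    · rintro ⟨⟨h, h'⟩, h''⟩
      have h3 : X.renewalTime g s = i := h'
      rw [h3]
      exact ⟨⟨h, h''⟩, rfl⟩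
  rw [h1, h2, X.measure_inter_timeToRenewal ((hD i).inter (hE i))]

theorem measure_frameLength [IsProbabilityMeasure P] (X : net.Run P) (g : ℕ) (T : Set ℕ) :
    P (X.frameLength g ⁻¹' T) = ∑' k : T, geomWeight net k := by
  simpa using X.measure_inter_frameLength g (D := fun _ => Set.univ)
    (fun _ => MeasurableSet.univ) T

/-- The length of a renewal interval is independent of the past at its beginning. -/
theorem indepFun_frameLength [IsProbabilityMeasure P] (X : net.Run P) (g : ℕ)
    {β : Type*} [MeasurableSpace β] {U : ℕ → S → β} (hU : ∀ i, Measurable[X.hist i] (U i)) :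
    IndepFun (fun s => U (X.renewalTime g s) s) (X.frameLength g) P := by
  rw [indepFun_iff_measure_inter_preimage_eq_mul]
  intro B T hB _
  rw [X.measure_frameLength]
  exact X.measure_inter_frameLength g (D := fun i => U i ⁻¹' B) (fun i => hU i hB) T

/-- The series is shifted by one because an interval has at least one slot, so the weight of length
0 vanishes. -/
theorem lintegral_frameLength [IsProbabilityMeasure P] (X : net.Run P) (g : ℕ) {h : ℕ → ℝ}
    (hh : ∀ k, 0 ≤ h k) {c : ℝ}
    (hc : HasSum (fun k => h (k + 1) * ((1 - net.phi) ^ k * net.phi)) c) :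
    ∫⁻ s, ENNReal.ofReal (h (X.frameLength g s)) ∂P = ENNReal.ofReal c := by
  have hq : 0 ≤ 1 - net.phi := by linarith [net.phi_le_one]
  have hp := net.phi_pos.le
  have hm : Measurable fun k : ℕ => ENNReal.ofReal (h k) := measurable_from_nat
  rw [← lintegral_map hm (X.measurable_frameLength g), lintegral_countable']
  have h1 : ∀ k, (P.map (X.frameLength g)) {k} = geomWeight net k := by
    intro k
    rw [Measure.map_apply (X.measurable_frameLength g) (measurableSet_singleton _),
      X.measure_frameLength, tsum_singleton (b := k)]
  simp_rw [h1]
  rw [tsum_eq_zero_add' ENNReal.summable, ← hc.tsum_eq, ENNReal.ofReal_tsum_of_nonneg _ hc.summable]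
  · rw [geomWeight, mul_zero, zero_add]
    refine tsum_congr fun k => ?_
    rw [geomWeight, ENNReal.ofReal_mul (hh _), ENNReal.ofReal_mul (pow_nonneg hq _),
      ENNReal.ofReal_pow hq]
  · exact fun k => mul_nonneg (hh _) (mul_nonneg (pow_nonneg hq _) hp)

theorem integral_frameLength_comp [IsProbabilityMeasure P] (X : net.Run P) (g : ℕ) {h : ℕ → ℝ}
    (hh : ∀ k, 0 ≤ h k) {c : ℝ} (hc0 : 0 ≤ c)
    (hc : HasSum (fun k => h (k + 1) * ((1 - net.phi) ^ k * net.phi)) c) :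
    Integrable (fun s => h (X.frameLength g s)) P ∧ ∫ s, h (X.frameLength g s) ∂P = c := by
  have hm : Measurable fun s => h (X.frameLength g s) :=
    measurable_from_nat.comp (X.measurable_frameLength g)
  have hl := X.lintegral_frameLength g hh hc
  refine ⟨⟨hm.aestronglyMeasurable, ?_⟩, ?_⟩
  · rw [hasFiniteIntegral_iff_ofReal (Eventually.of_forall fun s => hh _), hl]
    exact ENNReal.ofReal_lt_top
  · rw [integral_eq_lintegral_of_nonneg_ae (Eventually.of_forall fun s => hh _)
      hm.aestronglyMeasurable, hl, ENNReal.toReal_ofReal hc0]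

theorem hasSum_geom_mean (net : RenewalNetwork N M W Z A) :
    HasSum (fun k : ℕ => ((k + 1 : ℕ) : ℝ) * ((1 - net.phi) ^ k * net.phi)) (1 / net.phi) := by
  have hp := net.phi_pos
  have hr : ‖1 - net.phi‖ < 1 := by
    rw [Real.norm_eq_abs, abs_lt]; constructor <;> linarith [net.phi_le_one]
  have h := (hasSum_choose_mul_geometric_of_norm_lt_one 1 hr).mul_right net.phi
  have hc : 1 / (1 - (1 - net.phi)) ^ (1 + 1) * net.phi = 1 / net.phi := by
    rw [sub_sub_cancel]; field_simp
  rw [hc] at h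
  refine h.congr_fun fun k => ?_
  rw [Nat.choose_one_right]
  ring

theorem hasSum_geom_sq (net : RenewalNetwork N M W Z A) :
    HasSum (fun k : ℕ => ((k + 1 : ℕ) : ℝ) ^ 2 * ((1 - net.phi) ^ k * net.phi))
      ((2 - net.phi) / net.phi ^ 2) := by
  have hp := net.phi_pos
  have hr : ‖1 - net.phi‖ < 1 := by
    rw [Real.norm_eq_abs, abs_lt]; constructor <;> linarith [net.phi_le_one]
  -- Uses `(k + 1)² = 2 * choose (k + 2) 2 - (k + 1)`.
  have h := ((hasSum_choose_mul_geometric_of_norm_lt_one 2 hr).mul_right (2 * net.phi)).sub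
    (hasSum_geom_mean net)
  have hc : 1 / (1 - (1 - net.phi)) ^ (2 + 1) * (2 * net.phi) - 1 / net.phi
      = (2 - net.phi) / net.phi ^ 2 := by
    rw [sub_sub_cancel]; field_simp; ring
  rw [hc] at h
  refine h.congr_fun fun k => ?_
  rw [Nat.cast_choose_two]
  push_cast
  ring

theorem integrable_frameLength [IsProbabilityMeasure P] (X : net.Run P) (g : ℕ) :
    Integrable (fun s => (X.frameLength g s : ℝ)) P :=
  (X.integral_frameLength_comp g (h := fun k => (k : ℝ)) (fun k => k.cast_nonneg)
    (one_div_nonneg.2 net.phi_pos.le) (hasSum_geom_mean net)).1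

theorem integral_frameLength [IsProbabilityMeasure P] (X : net.Run P) (g : ℕ) :
    ∫ s, (X.frameLength g s : ℝ) ∂P = 1 / net.phi :=
  (X.integral_frameLength_comp g (h := fun k => (k : ℝ)) (fun k => k.cast_nonneg)
    (one_div_nonneg.2 net.phi_pos.le) (hasSum_geom_mean net)).2

theorem secondMoment_nonneg (net : RenewalNetwork N M W Z A) :
    0 ≤ (2 - net.phi) / net.phi ^ 2 :=
  div_nonneg (by linarith [net.phi_le_one]) (sq_nonneg _)

theorem integrable_frameLength_sq [IsProbabilityMeasure P] (X : net.Run P) (g : ℕ) :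
    Integrable (fun s => (X.frameLength g s : ℝ) ^ 2) P :=
  (X.integral_frameLength_comp g (h := fun k => (k : ℝ) ^ 2) (fun _ => sq_nonneg _)
    (secondMoment_nonneg net) (hasSum_geom_sq net)).1

theorem integral_frameLength_sq [IsProbabilityMeasure P] (X : net.Run P) (g : ℕ) :
    ∫ s, (X.frameLength g s : ℝ) ^ 2 ∂P = (2 - net.phi) / net.phi ^ 2 :=
  (X.integral_frameLength_comp g (h := fun k => (k : ℝ) ^ 2) (fun _ => sq_nonneg _)
    (secondMoment_nonneg net) (hasSum_geom_sq net)).2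

theorem measurable_frameLength_real (X : net.Run P) (g : ℕ) :
    Measurable fun s => (X.frameLength g s : ℝ) :=
  measurable_from_nat.comp (X.measurable_frameLength g)

theorem measurable_renewalTime_real (X : net.Run P) (g : ℕ) :
    Measurable fun s => (X.renewalTime g s : ℝ) :=
  measurable_from_nat.comp (X.measurable_renewalTime g)

theorem memLp_frameLength [IsProbabilityMeasure P] (X : net.Run P) (g : ℕ) :
    MemLp (fun s => (X.frameLength g s : ℝ)) 2 P :=
  (memLp_two_iff_integrable_sq (X.measurable_frameLength_real g).aestronglyMeasurable).2
    (X.integrable_frameLength_sq g)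

theorem memLp_renewalTime [IsProbabilityMeasure P] (X : net.Run P) (g : ℕ) :
    MemLp (fun s => (X.renewalTime g s : ℝ)) 2 P := by
  induction g with
  | zero => simp [renewalTime]
  | succ g ih =>
    simp_rw [renewalTime_succ, Nat.cast_add]
    exact ih.add (X.memLp_frameLength g)

theorem integrable_renewalTime [IsProbabilityMeasure P] (X : net.Run P) (g : ℕ) :
    Integrable (fun s => (X.renewalTime g s : ℝ)) P :=
  (X.memLp_renewalTime g).integrable (by norm_num)

theorem integral_renewalTime [IsProbabilityMeasure P] (X : net.Run P) (g : ℕ) :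
    ∫ s, (X.renewalTime g s : ℝ) ∂P = g / net.phi := by
  induction g with
  | zero => simp [renewalTime]
  | succ g ih =>
    simp_rw [renewalTime_succ, Nat.cast_add]
    rw [integral_add (X.integrable_renewalTime g) (X.integrable_frameLength g), ih,
      X.integral_frameLength]
    push_cast; ring

/-- Variances add because `t_g` is known when the next interval starts, and the variance of one
length is at most its second moment. Linear growth is what makes the fluctuations of `t_g` of order
`√g`. -/
theorem variance_renewalTime_le [IsProbabilityMeasure P] (X : net.Run P) (g : ℕ) :
    Var[fun s => (X.renewalTime g s : ℝ); P] ≤ g * ((2 - net.phi) / net.phi ^ 2) := by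
  induction g with
  | zero => simp [renewalTime, variance, evariance]
  | succ g ih =>
    have hind : IndepFun (fun s => (X.renewalTime g s : ℝ)) (fun s => (X.frameLength g s : ℝ)) P :=
      (X.indepFun_frameLength g (U := fun i _ => (i : ℝ)) (fun i => measurable_const)).comp
        measurable_id (measurable_from_nat (f := fun k : ℕ => (k : ℝ)))
    have h := hind.variance_add (X.memLp_renewalTime g) (X.memLp_frameLength g)
    have h2 : Var[fun s => (X.frameLength g s : ℝ); P] ≤ (2 - net.phi) / net.phi ^ 2 := by
      rw [← X.integral_frameLength_sq g]
      exact variance_le_expectation_sq (X.measurable_frameLength_real g).aestronglyMeasurable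
    have h3 : (fun s => (X.renewalTime (g + 1) s : ℝ))
        = (fun s => (X.renewalTime g s : ℝ)) + fun s => (X.frameLength g s : ℝ) := by
      ext s; simp [renewalTime_succ]
    rw [h3, h]
    push_cast
    linarith

/-- The triangle inequality through the mean `g/φ`; the centred part is bounded by the standard
deviation. -/
theorem integral_abs_renewalTime_sub_le [IsProbabilityMeasure P] (X : net.Run P) (g : ℕ) (t : ℝ) :
    ∫ s, |(X.renewalTime g s : ℝ) - t| ∂P
      ≤ √(g * ((2 - net.phi) / net.phi ^ 2)) + |g / net.phi - t| := by
  set Y : S → ℝ := fun s => (X.renewalTime g s : ℝ) - g / net.phi with hY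
  have hYL : MemLp Y 2 P := (X.memLp_renewalTime g).sub (memLp_const _)
  have hYi : Integrable Y P := hYL.integrable (by norm_num)
  have h1 : (∫ s, |Y s| ∂P) ^ 2 ≤ ∫ s, Y s ^ 2 ∂P := by
    have := variance_nonneg (fun s => |Y s|) P
    rw [variance_eq_sub (X := fun s => |Y s|) hYL.abs] at this
    simpa [sq_abs] using this
  have h2 : ∫ s, Y s ^ 2 ∂P = Var[fun s => (X.renewalTime g s : ℝ); P] := by
    rw [variance_eq_integral (X.measurable_renewalTime_real g).aemeasurable,
      X.integral_renewalTime]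
  have h3 : ∫ s, |Y s| ∂P ≤ √(g * ((2 - net.phi) / net.phi ^ 2)) :=
    Real.le_sqrt_of_sq_le (h1.trans (h2.trans_le (X.variance_renewalTime_le g)))
  calc ∫ s, |(X.renewalTime g s : ℝ) - t| ∂P
      ≤ ∫ s, (|Y s| + |g / net.phi - t|) ∂P := by
        refine integral_mono ((X.integrable_renewalTime g).sub (integrable_const _)).abs
          (hYi.abs.add (integrable_const _)) fun s => ?_
        have := abs_add_le (Y s) (g / net.phi - t)
        simpa [hY] using this
    _ = ∫ s, |Y s| ∂P + |g / net.phi - t| := by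
        rw [integral_add hYi.abs (integrable_const _)]; simp
    _ ≤ _ := by gcongr

end Run

end RenewalNetwork

end RenewalTimes

/-! ### Queues: pathwise drift over an interval, Lipschitz bounds, integrability at renewal times.
-/

section Queues

/-- A `k`-step drift inequality that follows from a one-step drift inequality: if the squares of
the increments and of the drifts are bounded by `w`, then so are the cross terms. -/
theorem sq_le_of_step {q d w : ℕ → ℝ}
    (hstep : ∀ j, q (j + 1) ^ 2 ≤ q j ^ 2 + 2 * q j * d j + w j)
    (hinc : ∀ j, (q (j + 1) - q j) ^ 2 ≤ w j) (hd : ∀ j, d j ^ 2 ≤ w j) (k : ℕ) :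
    q k ^ 2 ≤ q 0 ^ 2 + 2 * q 0 * ∑ j ∈ Finset.range k, d j
      + k * ∑ j ∈ Finset.range k, w j := by
  -- Writing `q k - q 0` as a sum of `k` increments, each product with `d i` is handled by `2ab ≤ a²
  -- + b²`. The index `i` stays free so that the induction on `k` keeps `d i` fixed. In the main
  -- induction the terms then add up to exactly `(k + 1) * ∑ w`, which keeps the factor `σ²/2` in
  -- `B`.
  have hcross : ∀ i k, 2 * (q k - q 0) * d i ≤ ∑ j ∈ Finset.range k, w j + k * w i := by
    intro i k
    induction k with
    | zero => simp
    | succ k ih =>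
      rw [Finset.sum_range_succ]
      push_cast
      nlinarith [sq_nonneg (q (k + 1) - q k - d i), hinc k, hd i]
  induction k with
  | zero => simp
  | succ k ih =>
    rw [Finset.sum_range_succ, Finset.sum_range_succ]
    push_cast
    linarith [hstep k, hcross k k]

namespace RenewalNetwork

variable {N M : Type*} {W Z A : Type u}
  [MeasurableSpace W] [MeasurableSpace Z] [MeasurableSpace A]

/-- The difference of arrivals and services, for the actual and for the virtual queues. -/
def netInput (net : RenewalNetwork N M W Z A) : N ⊕ M → A × (W × Bool) × Z → ℝ :=
  Sum.elim (fun n p => net.arr n p - net.serv n p) (fun m p => net.pen m p - net.penAv m)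

/-- The contribution of a queue to `σ²`. -/
def inputSq (net : RenewalNetwork N M W Z A) : N ⊕ M → A × (W × Bool) × Z → ℝ :=
  Sum.elim (fun n p => net.serv n p ^ 2 + net.arr n p ^ 2)
    (fun m p => (net.pen m p - net.penAv m) ^ 2)

theorem measurable_netInput (net : RenewalNetwork N M W Z A) (i : N ⊕ M) :
    Measurable (net.netInput i) := by
  cases i with
  | inl n => exact (net.arr_meas n).sub (net.serv_meas n)
  | inr m => exact (net.pen_meas m).sub_const _

/-- The function `f` of action, outcome and state is bounded by `K` on the allowed actions. -/
def BoundedBy (net : RenewalNetwork N M W Z A) (f : A × (W × Bool) × Z → ℝ) (K : ℝ) : Prop :=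
  ∀ o z, ∀ a ∈ net.actions o z, |f (a, o, z)| ≤ K

theorem boundedBy_of_mem_Icc {net : RenewalNetwork N M W Z A} {f : A × (W × Bool) × Z → ℝ}
    {a b : ℝ} (h : ∀ o z, ∀ x ∈ net.actions o z, a ≤ f (x, o, z) ∧ f (x, o, z) ≤ b) :
    net.BoundedBy f (|a| + |b|) := by
  intro o z x hx
  obtain ⟨h1, h2⟩ := h o z x hx
  rw [abs_le]
  constructor <;> linarith [neg_abs_le a, le_abs_self b, abs_nonneg a, abs_nonneg b]

theorem BoundedBy.sub {net : RenewalNetwork N M W Z A} {f f' : A × (W × Bool) × Z → ℝ} {K K' : ℝ}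
    (h : net.BoundedBy f K) (h' : net.BoundedBy f' K') :
    net.BoundedBy (fun p => f p - f' p) (K + K') :=
  fun o z a ha => (abs_sub _ _).trans (add_le_add (h o z a ha) (h' o z a ha))

theorem boundedBy_serv (net : RenewalNetwork N M W Z A) (n : N) :
    net.BoundedBy (net.serv n) (|0| + |net.servMax n|) :=
  boundedBy_of_mem_Icc (net.serv_bdd n)

theorem boundedBy_arr (net : RenewalNetwork N M W Z A) (n : N) :
    net.BoundedBy (net.arr n) (|0| + |net.arrMax n|) :=
  boundedBy_of_mem_Icc (net.arr_bdd n)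

theorem boundedBy_pen (net : RenewalNetwork N M W Z A) (m : M) :
    net.BoundedBy (net.pen m) (|net.penMin m| + |net.penMax m|) :=
  boundedBy_of_mem_Icc (net.pen_bdd m)

theorem boundedBy_pen0 (net : RenewalNetwork N M W Z A) :
    net.BoundedBy net.pen0 (|net.pen0Min| + |net.pen0Max|) :=
  boundedBy_of_mem_Icc net.pen0_bdd

theorem exists_boundedBy_netInput (net : RenewalNetwork N M W Z A) (i : N ⊕ M) :
    ∃ K, net.BoundedBy (net.netInput i) K := by
  cases i with
  | inl n => exact ⟨_, (net.boundedBy_arr n).sub (net.boundedBy_serv n)⟩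
  | inr m => exact ⟨_, (net.boundedBy_pen m).sub (fun _ _ _ _ => le_refl |net.penAv m|)⟩

theorem exists_boundedBy_inputSq (net : RenewalNetwork N M W Z A) (i : N ⊕ M) :
    ∃ K, net.BoundedBy (net.inputSq i) K := by
  have hsq : ∀ {f : A × (W × Bool) × Z → ℝ} {K : ℝ}, net.BoundedBy f K →
      ∀ o z, ∀ a ∈ net.actions o z, f (a, o, z) ^ 2 ≤ K ^ 2 := fun h o z a ha =>
    sq_le_sq' (neg_le_of_abs_le (h o z a ha)) (le_of_abs_le (h o z a ha))
  cases i with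
  | inl n =>
    refine ⟨(|0| + |net.servMax n|) ^ 2 + (|0| + |net.arrMax n|) ^ 2, fun o z a ha => ?_⟩
    rw [inputSq, Sum.elim_inl, abs_of_nonneg (by positivity)]
    exact add_le_add (hsq (net.boundedBy_serv n) o z a ha) (hsq (net.boundedBy_arr n) o z a ha)
  | inr m =>
    obtain ⟨K, hK⟩ := net.exists_boundedBy_netInput (Sum.inr m : N ⊕ M)
    refine ⟨K ^ 2, fun o z a ha => ?_⟩
    rw [inputSq, Sum.elim_inr, abs_of_nonneg (by positivity)]
    exact hsq hK o z a ha

namespace Run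

variable {net : RenewalNetwork N M W Z A} {S : Type v} [mS : MeasurableSpace S] {P : Measure S}

/-- The actual and the virtual queues. -/
noncomputable def queue (X : net.Run P) : N ⊕ M → ℕ → S → ℝ := Sum.elim X.Q X.Y

theorem measurable_eval_hist (X : net.Run P) {f : A × (W × Bool) × Z → ℝ} (hf : Measurable f)
    (t : ℕ) : Measurable[X.hist (t + 1)] (X.eval f t) :=
  hf.comp ((X.act_meas t).prodMk ((X.out_meas t).prodMk
    ((X.state_meas t).mono (X.hist.mono (Nat.le_succ t)) le_rfl)))

theorem measurable_eval (X : net.Run P) {f : A × (W × Bool) × Z → ℝ} (hf : Measurable f)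
    (t : ℕ) : Measurable (X.eval f t) :=
  (X.measurable_eval_hist hf t).mono (X.hist.le _) le_rfl

theorem ae_act_mem (X : net.Run P) :
    ∀ᵐ s ∂P, ∀ t, X.act t s ∈ net.actions (X.out t s) (X.state t s) :=
  ae_all_iff.2 X.act_mem

theorem ae_abs_eval_le (X : net.Run P) {f : A × (W × Bool) × Z → ℝ} {K : ℝ}
    (hK : net.BoundedBy f K) : ∀ᵐ s ∂P, ∀ t, |X.eval f t s| ≤ K := by
  filter_upwards [X.ae_act_mem] with s hs t
  exact hK _ _ _ (hs t)

theorem integrable_eval [IsProbabilityMeasure P] (X : net.Run P) {f : A × (W × Bool) × Z → ℝ}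
    (hf : Measurable f) {K : ℝ} (hK : net.BoundedBy f K) (t : ℕ) : Integrable (X.eval f t) P := by
  refine (integrable_const K).mono' (X.measurable_eval hf t).aestronglyMeasurable ?_
  filter_upwards [X.ae_abs_eval_le hK] with s hs
  exact hs t

theorem measurable_queue_hist (X : net.Run P) (i : N ⊕ M) (t : ℕ) :
    Measurable[X.hist t] (X.queue i t) := by
  induction t with
  | zero => cases i <;> exact measurable_const
  | succ t ih =>
    have ih' := ih.mono (X.hist.mono (Nat.le_succ t)) le_rfl
    cases i with
    | inl n =>
      exact ((ih'.sub (X.measurable_eval_hist (net.serv_meas n) t)).max measurable_const).add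
        (X.measurable_eval_hist (net.arr_meas n) t)
    | inr m =>
      exact ((ih'.sub measurable_const).add
        (X.measurable_eval_hist (net.pen_meas m) t)).max measurable_const

theorem measurable_queue (X : net.Run P) (i : N ⊕ M) (t : ℕ) : Measurable (X.queue i t) :=
  (X.measurable_queue_hist i t).mono (X.hist.le _) le_rfl

theorem queue_zero (X : net.Run P) (i : N ⊕ M) (s : S) : X.queue i 0 s = 0 := by
  cases i <;> rfl

theorem ae_queue_nonneg (X : net.Run P) (i : N ⊕ M) : ∀ᵐ s ∂P, ∀ t, 0 ≤ X.queue i t s := by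
  filter_upwards [X.ae_act_mem] with s hs t
  cases t with
  | zero => rw [queue_zero]
  | succ t =>
    cases i with
    | inl n => exact add_nonneg (le_max_right _ _) (net.arr_bdd n _ _ _ (hs t)).1
    | inr m => exact le_max_right _ _

/-- The one-step drift inequality of a queue, with bounds on its increments. -/
theorem ae_queue_step (X : net.Run P) (i : N ⊕ M) : ∀ᵐ s ∂P, ∀ t,
    X.queue i (t + 1) s ^ 2 ≤ X.queue i t s ^ 2
        + 2 * X.queue i t s * X.eval (net.netInput i) t s + X.eval (net.inputSq i) t s ∧
      (X.queue i (t + 1) s - X.queue i t s) ^ 2 ≤ X.eval (net.inputSq i) t s ∧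
      X.eval (net.netInput i) t s ^ 2 ≤ X.eval (net.inputSq i) t s := by
  filter_upwards [X.ae_act_mem, X.ae_queue_nonneg i] with s hs hq t
  have h0 := hq t
  cases i with
  | inl n =>
    have hr := (net.arr_bdd n _ _ _ (hs t)).1
    have hm := (net.serv_bdd n _ _ _ (hs t)).1
    change 0 ≤ X.eval (net.arr n) t s at hr
    change 0 ≤ X.eval (net.serv n) t s at hm
    have hE : X.queue (Sum.inl n) (t + 1) s
      = max (X.queue (Sum.inl n) t s - X.eval (net.serv n) t s) 0 + X.eval (net.arr n) t s := rfl
    have hd : X.eval (net.netInput (Sum.inl n)) t s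
      = X.eval (net.arr n) t s - X.eval (net.serv n) t s := rfl
    have hw : X.eval (net.inputSq (Sum.inl n)) t s
      = X.eval (net.serv n) t s ^ 2 + X.eval (net.arr n) t s ^ 2 := rfl
    rw [hE, hd, hw]
    generalize X.queue (Sum.inl n) t s = q at *
    generalize X.eval (net.serv n) t s = μ at *
    generalize X.eval (net.arr n) t s = r at *
    -- The increment lies between `-μ` and `r`, both measured from nonnegative rates, so its square
    -- is at most `μ² + r²`; the discarded cross term `2μr` in `(r - μ)²` has the right sign.
    refine ⟨?_, ?_, by nlinarith⟩ <;>
      rcases max_cases (q - μ) 0 with ⟨h, h'⟩ | ⟨h, h'⟩ <;> rw [h] <;> nlinarith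
  | inr m =>
    have hE : X.queue (Sum.inr m) (t + 1) s
      = max (X.queue (Sum.inr m) t s - net.penAv m + X.eval (net.pen m) t s) 0 := rfl
    have hd : X.eval (net.netInput (Sum.inr m)) t s = X.eval (net.pen m) t s - net.penAv m := rfl
    have hw : X.eval (net.inputSq (Sum.inr m)) t s
      = (X.eval (net.pen m) t s - net.penAv m) ^ 2 := rfl
    rw [hE, hd, hw]
    generalize X.queue (Sum.inr m) t s = q at *
    generalize X.eval (net.pen m) t s = x at *
    refine ⟨?_, ?_, le_rfl⟩ <;>
      rcases max_cases (q - net.penAv m + x) 0 with ⟨h, h'⟩ | ⟨h, h'⟩ <;> rw [h] <;> nlinarith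

theorem ae_queue_frame_step (X : net.Run P) (i : N ⊕ M) : ∀ᵐ s ∂P, ∀ g,
    X.queue i (X.renewalTime (g + 1) s) s ^ 2 ≤ X.queue i (X.renewalTime g s) s ^ 2
      + 2 * X.queue i (X.renewalTime g s) s * X.frameSum (net.netInput i) g s
      + X.frameLength g s * X.frameSum (net.inputSq i) g s := by
  filter_upwards [X.ae_queue_step i] with s hs g
  exact sq_le_of_step (q := fun j => X.queue i (X.renewalTime g s + j) s)
    (fun j => (hs _).1) (fun j => (hs _).2.1) (fun j => (hs _).2.2) (X.frameLength g s)

/-- A queue is Lipschitz in time. -/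
theorem exists_ae_abs_queue_sub_le (X : net.Run P) (i : N ⊕ M) :
    ∃ K, 0 ≤ K ∧ ∀ᵐ s ∂P, ∀ t t', |X.queue i t s - X.queue i t' s| ≤ K * |(t : ℝ) - t'| := by
  obtain ⟨K, hK⟩ := net.exists_boundedBy_inputSq i
  refine ⟨√K, Real.sqrt_nonneg K, ?_⟩
  filter_upwards [X.ae_queue_step i, X.ae_abs_eval_le hK] with s hs hb
  have h1 : ∀ t, |X.queue i (t + 1) s - X.queue i t s| ≤ √K := fun t =>
    Real.abs_le_sqrt ((hs t).2.1.trans ((le_abs_self _).trans (hb t)))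
  have h2 : ∀ t k : ℕ, |X.queue i (t + k) s - X.queue i t s| ≤ √K * k := by
    intro t k
    induction k with
    | zero => simp
    | succ k ih =>
      have := abs_sub_le (X.queue i (t + k + 1) s) (X.queue i (t + k) s) (X.queue i t s)
      rw [← add_assoc]
      push_cast
      linarith [h1 (t + k)]
  intro t t'
  rcases le_total t t' with h | h <;> obtain ⟨k, rfl⟩ := Nat.exists_eq_add_of_le h
  · rw [abs_sub_comm]; simpa using h2 t k
  · simpa using h2 t' k

theorem measurable_frameSum (X : net.Run P) {f : A × (W × Bool) × Z → ℝ} (hf : Measurable f)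
    (g : ℕ) : Measurable (X.frameSum f g) := by
  have h1 : ∀ k, Measurable fun s => ∑ τ ∈ Finset.range k, X.eval f (X.renewalTime g s + τ) s :=
    fun k => Finset.measurable_sum _ fun τ _ =>
      measurable_comp_random (F := fun t s => X.eval f (t + τ) s)
        (fun t => X.measurable_eval hf (t + τ)) (X.measurable_renewalTime g)
  exact measurable_comp_random
    (F := fun k s => ∑ τ ∈ Finset.range k, X.eval f (X.renewalTime g s + τ) s) h1 (X.measurable_frameLength g)

theorem ae_abs_frameSum_le (X : net.Run P) {f : A × (W × Bool) × Z → ℝ} {K : ℝ}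
    (hK : net.BoundedBy f K) : ∀ᵐ s ∂P, ∀ g, |X.frameSum f g s| ≤ X.frameLength g s * K := by
  filter_upwards [X.ae_abs_eval_le hK] with s hs g
  refine (Finset.abs_sum_le_sum_abs _ _).trans ((Finset.sum_le_card_nsmul _ _ K fun τ _ =>
    hs _).trans_eq ?_)
  rw [Finset.card_range, nsmul_eq_mul]

theorem memLp_frameSum [IsProbabilityMeasure P] (X : net.Run P) {f : A × (W × Bool) × Z → ℝ}
    (hf : Measurable f) {K : ℝ} (hK : net.BoundedBy f K) (g : ℕ) :
    MemLp (X.frameSum f g) 2 P := by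
  refine ((X.memLp_frameLength g).mul_const K).of_le
    (X.measurable_frameSum hf g).aestronglyMeasurable ?_
  filter_upwards [X.ae_abs_frameSum_le hK] with s hs
  exact (hs g).trans (le_abs_self _)

theorem integrable_frameSum [IsProbabilityMeasure P] (X : net.Run P)
    {f : A × (W × Bool) × Z → ℝ} (hf : Measurable f) {K : ℝ} (hK : net.BoundedBy f K) (g : ℕ) :
    Integrable (X.frameSum f g) P :=
  (X.memLp_frameSum hf hK g).integrable (by norm_num)

theorem abs_integral_frameSum_le [IsProbabilityMeasure P] (X : net.Run P)
    {f : A × (W × Bool) × Z → ℝ} {K : ℝ} (hK : net.BoundedBy f K) (g : ℕ) :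
    |∫ s, X.frameSum f g s ∂P| ≤ K / net.phi := by
  have h : ∫ s, X.frameLength g s * K ∂P = K / net.phi := by
    rw [integral_mul_const, X.integral_frameLength]; ring
  rw [← h, ← Real.norm_eq_abs]
  refine norm_integral_le_of_norm_le ((X.integrable_frameLength g).mul_const K) ?_
  filter_upwards [X.ae_abs_frameSum_le hK] with s hs
  exact hs g

theorem integral_frameSum_le [IsProbabilityMeasure P] (X : net.Run P)
    {f : A × (W × Bool) × Z → ℝ} (hf : Measurable f) {K c : ℝ} (hK : net.BoundedBy f K)
    (hc : ∀ o z, ∀ a ∈ net.actions o z, f (a, o, z) ≤ c) (g : ℕ) :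
    ∫ s, X.frameSum f g s ∂P ≤ c / net.phi := by
  have h : ∫ s, X.frameLength g s * c ∂P = c / net.phi := by
    rw [integral_mul_const, X.integral_frameLength]; ring
  rw [← h]
  refine integral_mono_ae (X.integrable_frameSum hf hK g)
    ((X.integrable_frameLength g).mul_const c) ?_
  filter_upwards [X.ae_act_mem] with s hs
  refine (Finset.sum_le_card_nsmul _ _ c fun τ _ => hc _ _ _ (hs _)).trans_eq ?_
  rw [Finset.card_range, nsmul_eq_mul]

theorem le_integral_frameSum [IsProbabilityMeasure P] (X : net.Run P)
    {f : A × (W × Bool) × Z → ℝ} (hf : Measurable f) {K c : ℝ} (hK : net.BoundedBy f K)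
    (hc : ∀ o z, ∀ a ∈ net.actions o z, c ≤ f (a, o, z)) (g : ℕ) :
    c / net.phi ≤ ∫ s, X.frameSum f g s ∂P := by
  have h : ∫ s, X.frameLength g s * c ∂P = c / net.phi := by
    rw [integral_mul_const, X.integral_frameLength]; ring
  rw [← h]
  refine integral_mono_ae ((X.integrable_frameLength g).mul_const c)
    (X.integrable_frameSum hf hK g) ?_
  filter_upwards [X.ae_act_mem] with s hs
  refine Eq.trans_le ?_ (Finset.card_nsmul_le_sum _ _ c fun τ _ => hc _ _ _ (hs _))
  rw [Finset.card_range, nsmul_eq_mul]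

theorem sum_range_renewalTime (X : net.Run P) (F : ℕ → ℝ) (G : ℕ) (s : S) :
    ∑ τ ∈ Finset.range (X.renewalTime G s), F τ
      = ∑ g ∈ Finset.range G, ∑ τ ∈ Finset.range (X.frameLength g s),
          F (X.renewalTime g s + τ) := by
  induction G with
  | zero => simp [renewalTime]
  | succ G ih => rw [renewalTime_succ, Finset.sum_range_add, ih, Finset.sum_range_succ]

theorem measurable_queue_renewal (X : net.Run P) (i : N ⊕ M) (g : ℕ) :
    Measurable fun s => X.queue i (X.renewalTime g s) s :=
  measurable_comp_random (X.measurable_queue i) (X.measurable_renewalTime g)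

/-- A queue that starts empty and is Lipschitz in time is at most a multiple of `t_g`, which is
square integrable. -/
theorem memLp_queue_renewal [IsProbabilityMeasure P] (X : net.Run P) (i : N ⊕ M) (g : ℕ) :
    MemLp (fun s => X.queue i (X.renewalTime g s) s) 2 P := by
  obtain ⟨K, -, hK⟩ := X.exists_ae_abs_queue_sub_le i
  refine ((X.memLp_renewalTime g).const_mul K).of_le
    (X.measurable_queue_renewal i g).aestronglyMeasurable ?_
  filter_upwards [hK] with s hs
  have := hs (X.renewalTime g s) 0
  rw [queue_zero, sub_zero, Nat.cast_zero, sub_zero, Nat.abs_cast] at this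
  exact this.trans (le_abs_self _)

theorem integrable_queue_renewal [IsProbabilityMeasure P] (X : net.Run P) (i : N ⊕ M) (g : ℕ) :
    Integrable (fun s => X.queue i (X.renewalTime g s) s) P :=
  (X.memLp_queue_renewal i g).integrable (by norm_num)

theorem integrable_queue_mul_frameSum [IsProbabilityMeasure P] (X : net.Run P) (i : N ⊕ M)
    {f : A × (W × Bool) × Z → ℝ} (hf : Measurable f) {K : ℝ} (hK : net.BoundedBy f K) (g : ℕ) :
    Integrable (fun s => X.queue i (X.renewalTime g s) s * X.frameSum f g s) P :=
  (X.memLp_queue_renewal i g).integrable_mul (X.memLp_frameSum hf hK g)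

theorem indepFun_queue_frameLength [IsProbabilityMeasure P] (X : net.Run P) (i : N ⊕ M) (g : ℕ) :
    IndepFun (fun s => X.queue i (X.renewalTime g s) s) (fun s => (X.frameLength g s : ℝ)) P :=
  (X.indepFun_frameLength g (X.measurable_queue_hist i)).comp
    measurable_id (measurable_from_nat (f := fun k : ℕ => (k : ℝ)))

theorem integrable_queue_mul_frameLength [IsProbabilityMeasure P] (X : net.Run P) (i : N ⊕ M)
    (g : ℕ) : Integrable (fun s => X.queue i (X.renewalTime g s) s * X.frameLength g s) P :=
  (X.memLp_queue_renewal i g).integrable_mul (X.memLp_frameLength g)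

/-- The backlog at `t_g` is determined by the history before the interval, hence independent of its
length. -/
theorem integral_queue_mul_frameLength [IsProbabilityMeasure P] (X : net.Run P) (i : N ⊕ M)
    (g : ℕ) : ∫ s, X.queue i (X.renewalTime g s) s * X.frameLength g s ∂P
      = (∫ s, X.queue i (X.renewalTime g s) s ∂P) / net.phi := by
  rw [div_eq_mul_one_div, ← X.integral_frameLength g]
  exact (X.indepFun_queue_frameLength i g).integral_mul_eq_mul_integral
    (X.measurable_queue_renewal i g).aestronglyMeasurable
    (X.measurable_frameLength_real g).aestronglyMeasurable

end Run

end RenewalNetwork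

end Queues

/-! ### Drift-plus-penalty inequality over one renewal interval. -/

section Drift

namespace RenewalNetwork

variable {N M : Type*} {W Z A : Type u}
  [MeasurableSpace W] [MeasurableSpace Z] [MeasurableSpace A]

namespace Run

variable {net : RenewalNetwork N M W Z A} {S : Type v} [mS : MeasurableSpace S] {P : Measure S}

theorem measurable_Theta (X : net.Run P) (g : ℕ) : Measurable (X.Theta g) :=
  (measurable_pi_lambda _ fun n => X.measurable_queue_renewal (Sum.inl n) g).prodMk
    (measurable_pi_lambda _ fun m => X.measurable_queue_renewal (Sum.inr m) g)

theorem sigmaTheta_le (X : net.Run P) (g : ℕ) : X.sigmaTheta g ≤ mS :=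
  (X.measurable_Theta g).comap_le

theorem measurable_queue_sigmaTheta (X : net.Run P) (i : N ⊕ M) (g : ℕ) :
    Measurable[X.sigmaTheta g] fun s => X.queue i (X.renewalTime g s) s := by
  have h : Measurable[X.sigmaTheta g] (X.Theta g) := comap_measurable _
  cases i with
  | inl n => exact (measurable_pi_apply n).comp (measurable_fst.comp h)
  | inr m => exact (measurable_pi_apply m).comp (measurable_snd.comp h)

theorem indepFun_Theta_frameLength [IsProbabilityMeasure P] (X : net.Run P) (g : ℕ) :
    IndepFun (X.Theta g) (X.frameLength g) P :=
  X.indepFun_frameLength g (U := fun t s => (fun n => X.Q n t s, fun m => X.Y m t s)) fun t =>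
    Measurable.prod ((@measurable_pi_iff _ _ _ (X.hist t) _ _).2 fun n => X.measurable_queue_hist (Sum.inl n) t)
      ((@measurable_pi_iff _ _ _ (X.hist t) _ _).2 fun m => X.measurable_queue_hist (Sum.inr m) t)

/-- Since `T_g` is independent of `Θ(t_g)`, the conditional second moment is almost surely constant,
with the same value for every `g`; the essential supremum and the supremum disappear. -/
theorem driftConst_eq [IsProbabilityMeasure P] (X : net.Run P) (sigmaSq : ℝ) :
    X.driftConst sigmaSq = sigmaSq / 2 * ((2 - net.phi) / net.phi ^ 2) := by
  have h : ∀ g, essSup (P[fun s => (X.frameLength g s : ℝ) ^ 2 | X.sigmaTheta g]) P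
      = (2 - net.phi) / net.phi ^ 2 := by
    intro g
    have hm : Measurable[MeasurableSpace.comap (X.frameLength g) inferInstance]
        fun s => (X.frameLength g s : ℝ) ^ 2 :=
      (measurable_from_nat (f := fun k : ℕ => (k : ℝ) ^ 2)).comp (comap_measurable _)
    rw [essSup_congr_ae (condExp_indep_eq (X.measurable_frameLength g).comap_le (X.sigmaTheta_le g)
      hm.stronglyMeasurable (X.indepFun_Theta_frameLength g).symm), essSup_const',
      X.integral_frameLength_sq]
  rw [driftConst]
  simp_rw [h]
  rw [ciSup_const]

theorem frameSum_inl (X : net.Run P) (n : N) (g : ℕ) :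
    X.frameSum (net.netInput (Sum.inl n)) g
      = -X.frameSum (fun p => net.serv n p - net.arr n p) g := by
  ext s
  simp only [frameSum, Pi.neg_apply, ← Finset.sum_neg_distrib]
  exact Finset.sum_congr rfl fun τ _ => (neg_sub _ _).symm

theorem frameSum_inr (X : net.Run P) (m : M) (g : ℕ) :
    X.frameSum (net.netInput (Sum.inr m)) g
      = -fun s => X.frameLength g s * net.penAv m - X.frameSum (net.pen m) g s := by
  ext s
  simp only [frameSum, Pi.neg_apply, neg_sub]
  rw [eq_sub_iff_add_eq, ← nsmul_eq_mul]
  nth_rw 2 [← Finset.card_range (X.frameLength g s)]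
  rw [← Finset.sum_const, ← Finset.sum_add_distrib]
  exact Finset.sum_congr rfl fun τ _ => sub_add_cancel _ _

variable [Fintype N] [Fintype M]

/-- The backlogs at `t_g` are coordinates of `Θ(t_g)` and can be moved inside the conditional
expectations. In this form the expression is integrable and its mean follows from the tower
property. -/
theorem driftPlusPenalty_ae_eq [IsProbabilityMeasure P] (X : net.Run P) (V : ℝ) (g : ℕ) :
    X.driftPlusPenalty V g =ᵐ[P]
      (∑ i, P[fun s => X.queue i (X.renewalTime g s) s * X.frameSum (net.netInput i) g s
        | X.sigmaTheta g]) + V • P[X.frameSum net.pen0 g | X.sigmaTheta g] := by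
  have hpull : ∀ i, P[fun s => X.queue i (X.renewalTime g s) s * X.frameSum (net.netInput i) g s
      | X.sigmaTheta g] =ᵐ[P] fun s => X.queue i (X.renewalTime g s) s
        * P[X.frameSum (net.netInput i) g | X.sigmaTheta g] s := by
    intro i
    obtain ⟨K, hK⟩ := net.exists_boundedBy_netInput i
    exact condExp_mul_of_stronglyMeasurable_left
      (X.measurable_queue_sigmaTheta i g).stronglyMeasurable
      (X.integrable_queue_mul_frameSum i (net.measurable_netInput i) hK g)
      (X.integrable_frameSum (net.measurable_netInput i) hK g)
  have hl : ∀ n, P[X.frameSum (net.netInput (Sum.inl n)) g | X.sigmaTheta g]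
      =ᵐ[P] -P[X.frameSum (fun p => net.serv n p - net.arr n p) g | X.sigmaTheta g] := by
    intro n
    rw [frameSum_inl]
    exact condExp_neg _ _
  have hr : ∀ m, P[X.frameSum (net.netInput (Sum.inr m)) g | X.sigmaTheta g]
      =ᵐ[P] -P[fun s => X.frameLength g s * net.penAv m - X.frameSum (net.pen m) g s
        | X.sigmaTheta g] := by
    intro m
    rw [frameSum_inr]
    exact condExp_neg _ _
  filter_upwards [ae_all_iff.2 hpull, ae_all_iff.2 hl, ae_all_iff.2 hr] with s h1 h2 h3
  simp only [driftPlusPenalty, Pi.add_apply, Finset.sum_apply, Pi.smul_apply, smul_eq_mul, h1,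
    Fintype.sum_sum_type, h2, h3, Pi.neg_apply, mul_neg, Finset.sum_neg_distrib]
  rfl

theorem integrable_driftPlusPenalty [IsProbabilityMeasure P] (X : net.Run P) (V : ℝ) (g : ℕ) :
    Integrable (X.driftPlusPenalty V g) P :=
  ((integrable_finsetSum' _ fun _ _ => integrable_condExp).add
    (integrable_condExp.smul V)).congr (X.driftPlusPenalty_ae_eq V g).symm

theorem integral_driftPlusPenalty [IsProbabilityMeasure P] (X : net.Run P) (V : ℝ) (g : ℕ) :
    ∫ s, X.driftPlusPenalty V g s ∂P
      = ∑ i, ∫ s, X.queue i (X.renewalTime g s) s * X.frameSum (net.netInput i) g s ∂P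
        + V * ∫ s, X.frameSum net.pen0 g s ∂P := by
  rw [integral_congr_ae (X.driftPlusPenalty_ae_eq V g),
    integral_add' (integrable_finsetSum' _ fun _ _ => integrable_condExp)
      (integrable_condExp.smul V)]
  simp only [Finset.sum_apply, Pi.smul_apply, smul_eq_mul]
  rw [integral_finsetSum _ fun _ _ => integrable_condExp, integral_const_mul,
    integral_condExp (X.sigmaTheta_le g)]
  simp_rw [integral_condExp (X.sigmaTheta_le g)]

theorem weightedCost_eq (X : net.Run P) (V : ℝ) (θ : (N → ℝ) × (M → ℝ)) :
    X.weightedCost V θ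
      = ∑ i, Sum.elim θ.1 θ.2 i * ∫ s, X.frameSum (net.netInput i) 0 s ∂P
        + V * ∫ s, X.frameSum net.pen0 0 s ∂P := by
  simp only [weightedCost, Fintype.sum_sum_type, Sum.elim_inl, Sum.elim_inr, frameSum_inl,
    frameSum_inr, Pi.neg_apply, integral_neg, mul_neg, Finset.sum_neg_distrib]
  ring

end Run

theorem sspValue_le [Fintype N] [Fintype M] {net : RenewalNetwork N M W Z A} (V : ℝ)
    (θ : (N → ℝ) × (M → ℝ)) {S' : Type u} [MeasurableSpace S'] {P' : Measure S'}
    [IsProbabilityMeasure P'] (X' : net.Run P') : net.sspValue V θ ≤ X'.weightedCost V θ := by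
  refine csInf_le ?_ ⟨S', _, P', inferInstance, X', rfl⟩
  choose K hK using net.exists_boundedBy_netInput
  -- The infimum is taken over a set bounded below: for every run, an interval sum of a function
  -- bounded by `K` has mean at most `K / φ` in absolute value, because the mean length is always `1
  -- / φ`.
  refine ⟨-(∑ i, |Sum.elim θ.1 θ.2 i| * (K i / net.phi)
    + |V| * ((|net.pen0Min| + |net.pen0Max|) / net.phi)), ?_⟩
  rintro _ ⟨S₁, _, P₁, _, X₁, rfl⟩
  refine neg_le_of_abs_le ?_
  rw [Run.weightedCost_eq]
  refine (abs_add_le _ _).trans (add_le_add ((Finset.abs_sum_le_sum_abs _ _).trans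
    (Finset.sum_le_sum fun i _ => ?_)) ?_) <;> rw [abs_mul]
  · exact mul_le_mul_of_nonneg_left (X₁.abs_integral_frameSum_le (hK i) 0) (abs_nonneg _)
  · exact mul_le_mul_of_nonneg_left (X₁.abs_integral_frameSum_le net.boundedBy_pen0 0)
      (abs_nonneg _)

namespace Run

variable {net : RenewalNetwork N M W Z A} {S : Type v} [mS : MeasurableSpace S] {P : Measure S}
  [Fintype N] [Fintype M]

/-- The expected total backlog at the renewal time `t_g`. -/
noncomputable def meanBacklog (X : net.Run P) (g : ℕ) : ℝ :=
  ∑ i, ∫ s, X.queue i (X.renewalTime g s) s ∂P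

/-- The expected value of the Lyapunov function `½ ∑ q²` at the renewal time `t_g`. -/
noncomputable def meanLyapunov (X : net.Run P) (g : ℕ) : ℝ :=
  (∑ i, ∫ s, X.queue i (X.renewalTime g s) s ^ 2 ∂P) / 2

theorem meanLyapunov_zero (X : net.Run P) : X.meanLyapunov 0 = 0 := by
  simp [meanLyapunov, renewalTime, queue_zero]

theorem meanLyapunov_nonneg (X : net.Run P) (g : ℕ) : 0 ≤ X.meanLyapunov g :=
  div_nonneg (Finset.sum_nonneg fun _ _ => integral_nonneg fun _ => sq_nonneg _) (by norm_num)

theorem ae_sum_inputSq_le (X : net.Run P) {sigmaSq : ℝ}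
    (hsigma : ∀ t, ∀ᵐ s ∂P,
      (∑ n, (X.eval (net.serv n) t s ^ 2 + X.eval (net.arr n) t s ^ 2))
        + (∑ m, (X.eval (net.pen m) t s - net.penAv m) ^ 2) ≤ sigmaSq) :
    ∀ᵐ s ∂P, ∀ g, ∑ i, X.frameLength g s * X.frameSum (net.inputSq i) g s
      ≤ sigmaSq * (X.frameLength g s : ℝ) ^ 2 := by
  filter_upwards [ae_all_iff.2 hsigma] with s hs g
  simp only [frameSum]
  rw [← Finset.mul_sum, Finset.sum_comm, pow_two, mul_left_comm]
  refine mul_le_mul_of_nonneg_left ?_ (Nat.cast_nonneg _)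
  have h : ∀ τ ∈ Finset.range (X.frameLength g s),
      ∑ i, X.eval (net.inputSq i) (X.renewalTime g s + τ) s ≤ sigmaSq := by
    intro τ _
    rw [Fintype.sum_sum_type]
    exact hs _
  refine (Finset.sum_le_card_nsmul _ _ _ h).trans_eq ?_
  rw [Finset.card_range, nsmul_eq_mul, mul_comm]

/-- The expected drift of the Lyapunov function over one renewal interval. -/
theorem meanLyapunov_succ_le [IsProbabilityMeasure P] (X : net.Run P) {sigmaSq : ℝ}
    (hsigma : ∀ t, ∀ᵐ s ∂P,
      (∑ n, (X.eval (net.serv n) t s ^ 2 + X.eval (net.arr n) t s ^ 2))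
        + (∑ m, (X.eval (net.pen m) t s - net.penAv m) ^ 2) ≤ sigmaSq) (g : ℕ) :
    X.meanLyapunov (g + 1) ≤ X.meanLyapunov g + X.driftConst sigmaSq
      + ∑ i, ∫ s, X.queue i (X.renewalTime g s) s * X.frameSum (net.netInput i) g s ∂P := by
  have hq : ∀ i g, Integrable (fun s => X.queue i (X.renewalTime g s) s ^ 2) P := fun i g =>
    (X.memLp_queue_renewal i g).integrable_sq
  have hqd : ∀ i, Integrable
      (fun s => X.queue i (X.renewalTime g s) s * X.frameSum (net.netInput i) g s) P := fun i => by
    obtain ⟨K, hK⟩ := net.exists_boundedBy_netInput i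
    exact X.integrable_queue_mul_frameSum i (net.measurable_netInput i) hK g
  have hT := (X.integrable_frameLength_sq g).const_mul sigmaSq
  have hA : Integrable (fun s => ∑ i, X.queue i (X.renewalTime g s) s ^ 2) P :=
    integrable_finsetSum _ fun i _ => hq i g
  have hB : Integrable (fun s => 2 * ∑ i,
      X.queue i (X.renewalTime g s) s * X.frameSum (net.netInput i) g s) P :=
    (integrable_finsetSum _ fun i _ => hqd i).const_mul 2
  have hmono : ∫ s, ∑ i, X.queue i (X.renewalTime (g + 1) s) s ^ 2 ∂P
      ≤ ∫ s, (∑ i, X.queue i (X.renewalTime g s) s ^ 2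
        + 2 * ∑ i, X.queue i (X.renewalTime g s) s * X.frameSum (net.netInput i) g s
        + sigmaSq * (X.frameLength g s : ℝ) ^ 2) ∂P := by
    refine integral_mono_ae (integrable_finsetSum _ fun i _ => hq i (g + 1))
      ((hA.add hB).add hT) ?_
    filter_upwards [ae_all_iff.2 X.ae_queue_frame_step, X.ae_sum_inputSq_le hsigma] with s h1 h2
    calc ∑ i, X.queue i (X.renewalTime (g + 1) s) s ^ 2
        ≤ ∑ i, (X.queue i (X.renewalTime g s) s ^ 2
          + 2 * (X.queue i (X.renewalTime g s) s * X.frameSum (net.netInput i) g s)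
          + X.frameLength g s * X.frameSum (net.inputSq i) g s) :=
          Finset.sum_le_sum fun i _ => by linarith [h1 i g]
      _ ≤ _ := by
          rw [Finset.sum_add_distrib, Finset.sum_add_distrib, ← Finset.mul_sum]
          exact add_le_add le_rfl (h2 g)
  rw [integral_add (by exact hA.add hB) hT, integral_add hA hB, integral_const_mul,
    integral_const_mul, integral_finsetSum _ fun i _ => hq i (g + 1),
    integral_finsetSum _ fun i _ => hq i g, integral_finsetSum _ fun i _ => hqd i,
    X.integral_frameLength_sq] at hmono
  rw [meanLyapunov, meanLyapunov, driftConst_eq]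
  linarith

/-- The drift-plus-penalty inequality over one renewal interval, against a run that starts
afresh. -/
theorem meanLyapunov_add_penalty_le [IsProbabilityMeasure P] (X : net.Run P) {V sigmaSq C δ : ℝ}
    (hsigma : ∀ t, ∀ᵐ s ∂P,
      (∑ n, (X.eval (net.serv n) t s ^ 2 + X.eval (net.arr n) t s ^ 2))
        + (∑ m, (X.eval (net.pen m) t s - net.penAv m) ^ 2) ≤ sigmaSq)
    (happrox : ∀ g, ∀ᵐ s ∂P,
      X.driftPlusPenalty V g s ≤ net.sspValue V (X.Theta g s)
        + C + δ * (∑ n, X.Q n (X.renewalTime g s) s)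
        + δ * (∑ m, X.Y m (X.renewalTime g s) s) + V * δ)
    {S' : Type u} [MeasurableSpace S'] {P' : Measure S'} [IsProbabilityMeasure P']
    (X' : net.Run P') (g : ℕ) :
    X.meanLyapunov (g + 1) + V * ∫ s, X.frameSum net.pen0 g s ∂P
      ≤ X.meanLyapunov g + X.driftConst sigmaSq + C + δ * X.meanBacklog g + V * δ
        + ∑ i, (∫ s, X.queue i (X.renewalTime g s) s ∂P)
            * (∫ s, X'.frameSum (net.netInput i) 0 s ∂P')
        + V * ∫ s, X'.frameSum net.pen0 0 s ∂P' := by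
  set c : N ⊕ M → ℝ := fun i => ∫ s, X'.frameSum (net.netInput i) 0 s ∂P'
  set c0 : ℝ := ∫ s, X'.frameSum net.pen0 0 s ∂P'
  have hq : ∀ i, Integrable (fun s => X.queue i (X.renewalTime g s) s) P := fun i =>
    X.integrable_queue_renewal i g
  have hint : Integrable (fun s => ∑ i, X.queue i (X.renewalTime g s) s * (c i + δ)) P :=
    integrable_finsetSum _ fun i _ => (hq i).mul_const _
  -- For each sample point the weights are frozen at its own `Θ(t_g)`, while `c` and `c0` are
  -- constants computed on another probability space. The bound is thus affine in the backlogs, and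
  -- integrating it gives products of expectations.
  have h := integral_mono_ae (X.integrable_driftPlusPenalty V g)
    (hint.add (integrable_const (V * c0 + C + V * δ))) (by
      filter_upwards [happrox g] with s hs
      have h1 := sspValue_le V (X.Theta g s) X'
      rw [weightedCost_eq] at h1
      have h2 : ∑ i, X.queue i (X.renewalTime g s) s * (c i + δ)
          = ∑ i, Sum.elim (X.Theta g s).1 (X.Theta g s).2 i * c i
            + (δ * (∑ n, X.Q n (X.renewalTime g s) s)
              + δ * (∑ m, X.Y m (X.renewalTime g s) s)) := by
        have h3 : Sum.elim (X.Theta g s).1 (X.Theta g s).2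
            = fun i => X.queue i (X.renewalTime g s) s := by
          ext i; cases i <;> rfl
        have h4 : ∑ i, X.queue i (X.renewalTime g s) s
            = ∑ n, X.Q n (X.renewalTime g s) s + ∑ m, X.Y m (X.renewalTime g s) s :=
          Fintype.sum_sum_type _
        rw [h3, ← mul_add, ← h4, mul_comm δ, Finset.sum_mul, ← Finset.sum_add_distrib]
        simp only [mul_add]
      change _ ≤ ∑ i, X.queue i (X.renewalTime g s) s * (c i + δ) + (V * c0 + C + V * δ)
      linarith)
  rw [integral_driftPlusPenalty, integral_add' hint (integrable_const _),
    integral_finsetSum _ fun i _ => (hq i).mul_const _] at h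
  simp only [integral_mul_const, integral_const, probReal_univ, one_smul] at h
  simp only [mul_add, Finset.sum_add_distrib, ← Finset.sum_mul] at h
  have := X.meanLyapunov_succ_le hsigma g
  rw [meanBacklog]
  linarith

end Run

end RenewalNetwork

end Drift

/-! ### From renewal intervals to slot averages: penalties, constraints, strong stability. -/

section Performance

theorem tendsto_sqrt_succ_mul_div (c : ℝ) :
    Tendsto (fun t : ℕ => √((t + 1) * c) / t) atTop (nhds 0) := by
  have h1 : Tendsto (fun t : ℕ => c * (1 / (t : ℝ)) + c * (1 / (t : ℝ)) ^ 2) atTop (nhds 0) := by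
    have h := tendsto_one_div_atTop_nhds_zero_nat (𝕜 := ℝ)
    simpa using (h.const_mul c).add ((h.pow 2).const_mul c)
  have h2 := h1.sqrt
  rw [Real.sqrt_zero] at h2
  refine h2.congr fun t => ?_
  rcases Nat.eq_zero_or_pos t with rfl | ht
  · simp
  · have ht' : (0 : ℝ) < t := Nat.cast_pos.2 ht
    rw [show c * (1 / (t : ℝ)) + c * (1 / (t : ℝ)) ^ 2 = (t + 1) * c / (t : ℝ) ^ 2 by
      field_simp, Real.sqrt_div' _ (sq_nonneg _), Real.sqrt_sq ht'.le]

theorem abs_sum_range_sub_sum_range_le {F : ℕ → ℝ} {K : ℝ} (hF : ∀ j, |F j| ≤ K) (a b : ℕ) :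
    |∑ j ∈ Finset.range a, F j - ∑ j ∈ Finset.range b, F j| ≤ K * |(a : ℝ) - b| := by
  have h : ∀ b k : ℕ, |∑ j ∈ Finset.range (b + k), F j - ∑ j ∈ Finset.range b, F j| ≤ K * k := by
    intro b k
    rw [Finset.sum_range_add, add_sub_cancel_left]
    refine (Finset.abs_sum_le_sum_abs _ _).trans ((Finset.sum_le_card_nsmul _ _ K fun j _ =>
      hF _).trans_eq ?_)
    rw [Finset.card_range, nsmul_eq_mul, mul_comm]
  rcases le_total a b with hab | hab <;> obtain ⟨k, rfl⟩ := Nat.exists_eq_add_of_le hab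
  · rw [abs_sub_comm]; simpa using h a k
  · simpa using h b k

namespace RenewalNetwork

variable {N M : Type*} {W Z A : Type u}
  [MeasurableSpace W] [MeasurableSpace Z] [MeasurableSpace A]

namespace Run

variable {net : RenewalNetwork N M W Z A} {S : Type v} [mS : MeasurableSpace S] {P : Measure S}

theorem timeAvg_le_of_tendsto [IsProbabilityMeasure P] (X : net.Run P)
    {f : A × (W × Bool) × Z → ℝ} {K : ℝ} (hK : net.BoundedBy f K) {w : ℕ → ℝ} {l : ℝ}
    (hw : Tendsto w atTop (nhds l))
    (h : ∀ t : ℕ, 0 < t → (∑ τ ∈ Finset.range t, ∫ s, X.eval f τ s ∂P) / t ≤ w t) :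
    X.timeAvg f ≤ l := by
  rw [timeAvg, ← hw.limsup_eq]
  refine limsup_le_limsup ((eventually_gt_atTop 0).mono h) ?_ hw.isBoundedUnder_le
  -- Comparing real-valued limsups also needs the averages to be bounded below; `|K|` is used
  -- because `BoundedBy` does not force `K ≥ 0` when no action is allowed.
  refine IsBoundedUnder.isCoboundedUnder_le (isBoundedUnder_of ⟨-|K|, fun t => ?_⟩)
  have h1 : ∀ τ, |∫ s, X.eval f τ s ∂P| ≤ |K| := by
    intro τ
    have := norm_integral_le_of_norm_le_const (μ := P) (f := X.eval f τ) (C := |K|) (by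
      filter_upwards [X.ae_abs_eval_le hK] with s hs
      exact (hs τ).trans (le_abs_self K))
    simpa using this
  refine neg_le_of_abs_le ?_
  rw [abs_div, Nat.abs_cast]
  refine div_le_of_le_mul₀ (Nat.cast_nonneg _) (abs_nonneg _) ?_
  refine (Finset.abs_sum_le_sum_abs _ _).trans ((Finset.sum_le_card_nsmul _ _ |K| fun τ _ =>
    h1 τ).trans_eq ?_)
  rw [Finset.card_range, nsmul_eq_mul, mul_comm]

/-- An index of a renewal interval that starts around slot `t`. -/
noncomputable def renewalIndex (net : RenewalNetwork N M W Z A) (t : ℕ) : ℕ := ⌈net.phi * t⌉₊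

theorem renewalIndex_le (net : RenewalNetwork N M W Z A) (t : ℕ) :
    (renewalIndex net t : ℝ) ≤ t + 1 := by
  have h1 := Nat.ceil_lt_add_one (mul_nonneg net.phi_pos.le (Nat.cast_nonneg t))
  have h2 := mul_le_of_le_one_left (Nat.cast_nonneg (α := ℝ) t) net.phi_le_one
  rw [renewalIndex]
  linarith

theorem tendsto_renewalIndex_div (net : RenewalNetwork N M W Z A) :
    Tendsto (fun t : ℕ => (renewalIndex net t : ℝ) / t) atTop (nhds net.phi) :=
  (tendsto_nat_ceil_mul_div_atTop net.phi_pos.le).comp tendsto_natCast_atTop_atTop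

/-- A bound on the expected distance between slot `t` and the start of the corresponding renewal
interval. -/
noncomputable def renewalDeviation (net : RenewalNetwork N M W Z A) (t : ℕ) : ℝ :=
  √((t + 1) * ((2 - net.phi) / net.phi ^ 2)) + 1 / net.phi

theorem tendsto_renewalDeviation_div (net : RenewalNetwork N M W Z A) :
    Tendsto (fun t : ℕ => renewalDeviation net t / t) atTop (nhds 0) := by
  simp_rw [renewalDeviation, add_div]
  simpa using (tendsto_sqrt_succ_mul_div _).add
    (tendsto_const_div_atTop_nhds_zero_nat (1 / net.phi))

theorem integral_abs_renewalTime_renewalIndex_sub_le [IsProbabilityMeasure P] (X : net.Run P)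
    (t : ℕ) :
    ∫ s, |(X.renewalTime (renewalIndex net t) s : ℝ) - t| ∂P ≤ renewalDeviation net t := by
  have hp := net.phi_pos
  refine (X.integral_abs_renewalTime_sub_le _ t).trans (add_le_add (Real.sqrt_le_sqrt
    (mul_le_mul_of_nonneg_right (renewalIndex_le net t) (secondMoment_nonneg net))) ?_)
  have h1 := Nat.ceil_lt_add_one (mul_nonneg net.phi_pos.le (Nat.cast_nonneg t))
  have h2 := Nat.le_ceil (net.phi * t)
  -- Rounding `φt` up shifts the mean renewal time by at most `1/φ`, the second term of
  -- `renewalDeviation`.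
  rw [show (renewalIndex net t : ℝ) / net.phi - t = (renewalIndex net t - net.phi * t) / net.phi by
    field_simp, abs_div, abs_of_pos hp, renewalIndex, abs_of_nonneg (by linarith)]
  gcongr
  linarith

theorem integrable_abs_renewalTime_sub [IsProbabilityMeasure P] (X : net.Run P) (g t : ℕ) :
    Integrable (fun s => |(X.renewalTime g s : ℝ) - t|) P :=
  ((X.integrable_renewalTime g).sub (integrable_const _)).abs

theorem sum_renewalTime_eq (X : net.Run P) (f : A × (W × Bool) × Z → ℝ) (G : ℕ) (s : S) :
    ∑ τ ∈ Finset.range (X.renewalTime G s), X.eval f τ s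
      = ∑ g ∈ Finset.range G, X.frameSum f g s :=
  X.sum_range_renewalTime (fun τ => X.eval f τ s) G s

theorem integral_sum_renewalTime [IsProbabilityMeasure P] (X : net.Run P)
    {f : A × (W × Bool) × Z → ℝ} (hf : Measurable f) {K : ℝ} (hK : net.BoundedBy f K) (G : ℕ) :
    ∫ s, ∑ τ ∈ Finset.range (X.renewalTime G s), X.eval f τ s ∂P
      = ∑ g ∈ Finset.range G, ∫ s, X.frameSum f g s ∂P := by
  simp_rw [sum_renewalTime_eq]
  exact integral_finsetSum _ fun g _ => X.integrable_frameSum hf hK g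

/-- Slot averages are close to averages over a whole number of renewal intervals. -/
theorem sum_integral_eval_le [IsProbabilityMeasure P] (X : net.Run P)
    {f : A × (W × Bool) × Z → ℝ} (hf : Measurable f) {K : ℝ} (hK : net.BoundedBy f K) (t : ℕ) :
    ∑ τ ∈ Finset.range t, ∫ s, X.eval f τ s ∂P
      ≤ ∑ g ∈ Finset.range (renewalIndex net t), ∫ s, X.frameSum f g s ∂P
        + |K| * renewalDeviation net t := by
  have hi : Integrable (fun s => ∑ g ∈ Finset.range (renewalIndex net t), X.frameSum f g s) P :=
    integrable_finsetSum _ fun g _ => X.integrable_frameSum hf hK g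
  have hd := (X.integrable_abs_renewalTime_sub (renewalIndex net t) t).const_mul |K|
  have hmono : ∫ s, ∑ τ ∈ Finset.range t, X.eval f τ s ∂P
      ≤ ∫ s, (∑ g ∈ Finset.range (renewalIndex net t), X.frameSum f g s
        + |K| * |(X.renewalTime (renewalIndex net t) s : ℝ) - t|) ∂P := by
    refine integral_mono_ae (integrable_finsetSum _ fun τ _ => X.integrable_eval hf hK τ)
      (hi.add hd) ?_
    filter_upwards [X.ae_abs_eval_le hK] with s hs
    have h := abs_sum_range_sub_sum_range_le (F := fun τ => X.eval f τ s)
      (fun τ => (hs τ).trans (le_abs_self K)) (X.renewalTime (renewalIndex net t) s) t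
    rw [sum_renewalTime_eq] at h
    have := (abs_le.1 h).1
    change _ ≤ _ + _
    linarith
  rw [integral_add hi hd, integral_finsetSum _ fun τ _ => X.integrable_eval hf hK τ,
    integral_finsetSum _ fun g _ => X.integrable_frameSum hf hK g, integral_const_mul] at hmono
  have := mul_le_mul_of_nonneg_left (X.integral_abs_renewalTime_renewalIndex_sub_le t)
    (abs_nonneg K)
  linarith

/-- About `φt` intervals fill `t` slots, so `ρ/φ` per interval becomes `ρ` per slot; the mismatch at
the end is `O(√t)` and vanishes after division by `t`. -/
theorem timeAvg_le_of_frame_bound [IsProbabilityMeasure P] (X : net.Run P)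
    {f : A × (W × Bool) × Z → ℝ} (hf : Measurable f) {K : ℝ} (hK : net.BoundedBy f K) {ρ : ℝ}
    (h : ∀ G : ℕ, ∑ g ∈ Finset.range G, ∫ s, X.frameSum f g s ∂P ≤ G * (ρ / net.phi)) :
    X.timeAvg f ≤ ρ := by
  have hp := net.phi_pos
  have hw := ((tendsto_renewalIndex_div net).mul_const (ρ / net.phi)).add
    ((tendsto_renewalDeviation_div net).const_mul |K|)
  rw [mul_zero, add_zero, mul_div_cancel₀ _ hp.ne'] at hw
  refine X.timeAvg_le_of_tendsto hK hw fun t ht => ?_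
  have ht' : (0 : ℝ) < t := Nat.cast_pos.2 ht
  rw [div_mul_eq_mul_div, ← mul_div_assoc |K|, ← add_div]
  gcongr
  exact (X.sum_integral_eval_le hf hK t).trans (add_le_add (h _) le_rfl)

/-- Jensen's inequality: the squared mean of one queue is at most its second moment, which is one of
the terms of `2L`. -/
theorem integral_queue_renewal_le [IsProbabilityMeasure P] [Fintype N] [Fintype M] (X : net.Run P)
    (i : N ⊕ M) (g : ℕ) :
    ∫ s, X.queue i (X.renewalTime g s) s ∂P ≤ √(2 * X.meanLyapunov g) := by
  refine Real.le_sqrt_of_sq_le ?_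
  have h := variance_nonneg (fun s => X.queue i (X.renewalTime g s) s) P
  rw [variance_eq_sub (X.memLp_queue_renewal i g), sub_nonneg] at h
  refine h.trans ?_
  rw [meanLyapunov, mul_div_cancel₀ _ two_ne_zero]
  exact Finset.single_le_sum
    (f := fun i => ∫ s, X.queue i (X.renewalTime g s) s ^ 2 ∂P)
    (fun _ _ => integral_nonneg fun _ => sq_nonneg _) (Finset.mem_univ i)

/-- If the Lyapunov function grows at most linearly, the virtual queues are mean rate stable and
the penalty constraints hold. -/
theorem timeAvg_pen_le [IsProbabilityMeasure P] [Fintype N] [Fintype M] (X : net.Run P) {D : ℝ}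
    (hD : 0 ≤ D) (h : ∀ G : ℕ, X.meanLyapunov G ≤ G * D) (m : M) :
    X.timeAvg (net.pen m) ≤ net.penAv m := by
  obtain ⟨K, hK0, hK⟩ := X.exists_ae_abs_queue_sub_le (Sum.inr m)
  have hbd := net.boundedBy_pen m
  have hw := (((tendsto_renewalDeviation_div net).const_mul K).add
    (tendsto_sqrt_succ_mul_div (2 * D))).add_const (net.penAv m)
  rw [mul_zero, add_zero, zero_add] at hw
  refine X.timeAvg_le_of_tendsto hbd hw fun t ht => ?_
  have ht' : (0 : ℝ) < t := Nat.cast_pos.2 ht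
  rw [← mul_div_assoc, ← add_div, div_le_iff₀ ht', add_mul, div_mul_cancel₀ _ ht'.ne']
  -- Truncation at 0 only raises a virtual queue, so it dominates the accumulated excess of `x_m`
  -- over `x_m^av`.
  have hY : ∀ s t, ∑ τ ∈ Finset.range t, X.eval (net.pen m) τ s
      ≤ X.queue (Sum.inr m) t s + net.penAv m * t := by
    intro s t
    induction t with
    | zero => simp [queue_zero]
    | succ t ih =>
      rw [Finset.sum_range_succ]
      have : X.queue (Sum.inr m) t s - net.penAv m + X.eval (net.pen m) t s
        ≤ X.queue (Sum.inr m) (t + 1) s := le_max_left _ _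
      push_cast
      linarith
  have hq := X.integrable_queue_renewal (Sum.inr m) (renewalIndex net t)
  have hd := (X.integrable_abs_renewalTime_sub (renewalIndex net t) t).const_mul K
  have hmono : ∫ s, ∑ τ ∈ Finset.range t, X.eval (net.pen m) τ s ∂P
      ≤ ∫ s, (X.queue (Sum.inr m) (X.renewalTime (renewalIndex net t) s) s
        + K * |(X.renewalTime (renewalIndex net t) s : ℝ) - t| + net.penAv m * t) ∂P := by
    refine integral_mono_ae
      (integrable_finsetSum _ fun τ _ => X.integrable_eval (net.pen_meas m) hbd τ)
      ((hq.add hd).add (integrable_const _)) ?_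
    filter_upwards [hK] with s hs
    have h1 := (abs_le.1 (hs (X.renewalTime (renewalIndex net t) s) t)).1
    have h2 := hY s t
    change _ ≤ _ + _ + _
    linarith
  rw [integral_add (by exact hq.add hd) (integrable_const _), integral_add hq hd,
    integral_finsetSum _ fun τ _ => X.integrable_eval (net.pen_meas m) hbd τ,
    integral_const_mul] at hmono
  simp only [integral_const, probReal_univ, one_smul] at hmono
  have h1 := mul_le_mul_of_nonneg_left (X.integral_abs_renewalTime_renewalIndex_sub_le t) hK0
  have h2 := X.integral_queue_renewal_le (Sum.inr m) (renewalIndex net t)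
  have h3 : √(2 * X.meanLyapunov (renewalIndex net t)) ≤ √((t + 1) * (2 * D)) := by
    refine Real.sqrt_le_sqrt ?_
    have := mul_le_mul_of_nonneg_right (renewalIndex_le net t) hD
    linarith [h (renewalIndex net t)]
  linarith

theorem le_renewalTime (X : net.Run P) (g : ℕ) (s : S) : g ≤ X.renewalTime g s := by
  induction g with
  | zero => exact Nat.zero_le _
  | succ g ih =>
    rw [renewalTime_succ]
    have := X.frameLength_pos g s
    omega

/-- If the backlog at renewal times is bounded on average, so is the backlog of every queue. -/
theorem avgBacklog_queue_lt_top [IsProbabilityMeasure P] [Fintype N] [Fintype M] (X : net.Run P)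
    {D : ℝ} (h : ∀ G : ℕ, ∑ g ∈ Finset.range G, X.meanBacklog g ≤ G * D) (i : N ⊕ M) :
    avgBacklog P (X.queue i) < ⊤ := by
  obtain ⟨K, hK0, hK⟩ := X.exists_ae_abs_queue_sub_le i
  have hp := net.phi_pos
  set c := (2 - net.phi) / net.phi ^ 2 with hc
  have hqT := X.integrable_queue_mul_frameLength i
  have hT := fun g => (X.integrable_frameLength_sq g).const_mul K
  have hle : ∀ t : ℕ, ∑ τ ∈ Finset.range t, ∫⁻ s, ENNReal.ofReal (X.queue i τ s) ∂P
      ≤ ENNReal.ofReal (t * (D / net.phi + K * c)) := by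
    intro t
    rw [← lintegral_finsetSum _ fun τ _ => (X.measurable_queue i τ).ennreal_ofReal]
    have hI : Integrable (fun s => ∑ g ∈ Finset.range t,
        (X.queue i (X.renewalTime g s) s * X.frameLength g s
          + K * (X.frameLength g s : ℝ) ^ 2)) P :=
      integrable_finsetSum _ fun g _ => (hqT g).add (hT g)
    calc ∫⁻ s, ∑ τ ∈ Finset.range t, ENNReal.ofReal (X.queue i τ s) ∂P
        ≤ ∫⁻ s, ENNReal.ofReal (∑ g ∈ Finset.range t,
          (X.queue i (X.renewalTime g s) s * X.frameLength g s
            + K * (X.frameLength g s : ℝ) ^ 2)) ∂P := by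
          refine lintegral_mono_ae ?_
          filter_upwards [hK, X.ae_queue_nonneg i] with s hs hq
          rw [← ENNReal.ofReal_sum_of_nonneg fun τ _ => hq τ]
          refine ENNReal.ofReal_le_ofReal ?_
          -- Every interval has at least one slot, so the first `t` intervals cover the slots before
          -- `t`. Within an interval the backlog exceeds its starting value by at most `K * T_g`,
          -- which leads to the summands `q(t_g) T_g + K T_g²`.
          refine (Finset.sum_le_sum_of_subset_of_nonneg
            (Finset.range_subset_range.2 (X.le_renewalTime t s)) fun τ _ _ => hq τ).trans ?_
          rw [X.sum_range_renewalTime (fun τ => X.queue i τ s)]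
          refine Finset.sum_le_sum fun g _ => ?_
          have h1 : ∀ τ ∈ Finset.range (X.frameLength g s), X.queue i (X.renewalTime g s + τ) s
              ≤ X.queue i (X.renewalTime g s) s + K * X.frameLength g s := by
            intro τ hτ
            have h2 := (abs_le.1 (hs (X.renewalTime g s + τ) (X.renewalTime g s))).2
            rw [Nat.cast_add, add_sub_cancel_left, Nat.abs_cast] at h2
            have h3 : (τ : ℝ) ≤ X.frameLength g s :=
              Nat.cast_le.2 (Finset.mem_range.1 hτ).le
            have := mul_le_mul_of_nonneg_left h3 hK0
            linarith
          refine (Finset.sum_le_card_nsmul _ _ _ h1).trans_eq ?_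
          rw [Finset.card_range, nsmul_eq_mul]
          ring
      _ = ENNReal.ofReal (∫ s, ∑ g ∈ Finset.range t,
          (X.queue i (X.renewalTime g s) s * X.frameLength g s
            + K * (X.frameLength g s : ℝ) ^ 2) ∂P) := by
          refine (ofReal_integral_eq_lintegral_ofReal hI ?_).symm
          filter_upwards [X.ae_queue_nonneg i] with s hq
          exact Finset.sum_nonneg fun g _ => add_nonneg (mul_nonneg (hq _) (Nat.cast_nonneg _))
            (mul_nonneg hK0 (sq_nonneg _))
      _ ≤ _ := by
          refine ENNReal.ofReal_le_ofReal ?_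
          rw [integral_finsetSum _ fun g _ => by exact (hqT g).add (hT g)]
          have h1 : ∀ g, ∫ s, (X.queue i (X.renewalTime g s) s * X.frameLength g s
              + K * (X.frameLength g s : ℝ) ^ 2) ∂P ≤ X.meanBacklog g / net.phi + K * c := by
            intro g
            rw [integral_add (hqT g) (hT g), integral_const_mul, X.integral_frameLength_sq,
              X.integral_queue_mul_frameLength]
            gcongr
            refine Finset.single_le_sum
              (f := fun i => ∫ s, X.queue i (X.renewalTime g s) s ∂P) (fun j _ => ?_)
              (Finset.mem_univ i)
            refine integral_nonneg_of_ae ?_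
            filter_upwards [X.ae_queue_nonneg j] with s hs
            exact hs _
          refine (Finset.sum_le_sum fun g _ => h1 g).trans ?_
          rw [Finset.sum_add_distrib, ← Finset.sum_div, Finset.sum_const, Finset.card_range,
            nsmul_eq_mul, mul_add, ← mul_div_assoc (t : ℝ) D]
          exact add_le_add (div_le_div_of_nonneg_right (h t) hp.le) le_rfl
  refine lt_of_le_of_lt ?_ (ENNReal.ofReal_lt_top (r := D / net.phi + K * c))
  refine limsup_le_of_le (by isBoundedDefault) (Eventually.of_forall fun t => ?_)
  refine ENNReal.div_le_of_le_mul ?_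
  refine (hle t).trans_eq ?_
  rw [mul_comm, ENNReal.ofReal_mul' (Nat.cast_nonneg _), ENNReal.ofReal_natCast]

/-- The guarantees of a frame ratio, as bounds on the expected net input of every queue. -/
theorem integral_frameSum_netInput_le [IsProbabilityMeasure P] (X : net.Run P) {c : ℝ}
    (hpen : ∀ m, X.frameRatio (net.pen m) ≤ net.penAv m - c)
    (hserv : ∀ n, c ≤ X.frameRatio (fun p => net.serv n p - net.arr n p)) (i : N ⊕ M) :
    ∫ s, X.frameSum (net.netInput i) 0 s ∂P ≤ -(c / net.phi) := by
  have hp := net.phi_pos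
  cases i with
  | inl n =>
    have h := hserv n
    rw [frameRatio, X.integral_frameLength, div_div_eq_mul_div, div_one] at h
    simp only [frameSum_inl, Pi.neg_apply, integral_neg]
    rw [neg_le_neg_iff, div_le_iff₀ hp]
    exact h
  | inr m =>
    have h := hpen m
    rw [frameRatio, X.integral_frameLength, div_div_eq_mul_div, div_one, ← le_div_iff₀ hp] at h
    simp only [frameSum_inr, Pi.neg_apply, integral_neg]
    rw [integral_sub ((X.integrable_frameLength 0).mul_const _)
      (X.integrable_frameSum (net.pen_meas m) (net.boundedBy_pen m) 0), integral_mul_const,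
      X.integral_frameLength, neg_le_neg_iff, one_div_mul_eq_div]
    rw [sub_div] at h
    linarith

end Run

end RenewalNetwork

end Performance

/-! ### Telescoping and the comparison with the slack and optimal policies. -/

section MainTheorem

/-- Telescoping. It is applied once with `e` the interval penalty, and once with `e` the mean
backlog and `V` replaced by `ε - φδ`. -/
theorem mul_sum_le_of_drift {L e : ℕ → ℝ} {V b : ℝ} (h0 : L 0 = 0) (hL : ∀ g, 0 ≤ L g)
    (h : ∀ g, L (g + 1) + V * e g ≤ L g + b) (G : ℕ) :
    V * ∑ g ∈ Finset.range G, e g ≤ G * b := by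
  have h1 : ∀ G : ℕ, L G + V * ∑ g ∈ Finset.range G, e g ≤ G * b := by
    intro G
    induction G with
    | zero => simp [h0]
    | succ G ih =>
      rw [Finset.sum_range_succ]
      push_cast
      linarith [h G]
  linarith [h1 G, hL G]

end MainTheorem

theorem mainTheorem2 {N M : Type*} [Fintype N] [Fintype M] {W Z A : Type u}
    [MeasurableSpace W] [MeasurableSpace A]
    [MeasurableSpace Z] [Countable Z] [MeasurableSingletonClass Z]
    (net : RenewalNetwork N M W Z A)
    {S : Type v} [MeasurableSpace S] (P : Measure S) [IsProbabilityMeasure P]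
    (X : net.Run P)
    (ε : ℝ) (hε : 0 < ε) (hslack : net.Slackness ε) (hopt : net.OptimumAttained)
    (V : ℝ) (hV : 0 < V)
    (sigmaSq : ℝ)
    (hsigma : ∀ t, ∀ᵐ s ∂P,
      (∑ n, (X.eval (net.serv n) t s ^ 2 + X.eval (net.arr n) t s ^ 2))
        + (∑ m, (X.eval (net.pen m) t s - net.penAv m) ^ 2) ≤ sigmaSq)
    (C δ : ℝ) (hC : 0 ≤ C) (hδ : 0 ≤ δ) (hεδ : net.phi * δ < ε)
    (happrox : ∀ g, ∀ᵐ s ∂P,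
      X.driftPlusPenalty V g s ≤ net.sspValue V (X.Theta g s)
        + C + δ * (∑ n, X.Q n (X.renewalTime g s) s)
        + δ * (∑ m, X.Y m (X.renewalTime g s) s) + V * δ) :
    -- the constant `B` is at most its value for geometric renewal intervals
    X.driftConst sigmaSq ≤ sigmaSq * (2 - net.phi) / (2 * net.phi ^ 2) ∧
    -- strong stability of all queues, and the constraints on the time average penalties
    (∀ n, avgBacklog P (X.Q n) < ⊤) ∧
    (∀ m, avgBacklog P (X.Y m) < ⊤) ∧
    (∀ m, X.timeAvg (net.pen m) ≤ net.penAv m) ∧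
    -- the average backlog at renewal times
    (∀ g n, Integrable (fun s => X.Q n (X.renewalTime g s) s) P) ∧
    (∀ g m, Integrable (fun s => X.Y m (X.renewalTime g s) s) P) ∧
    (∀ G : ℕ, 0 < G →
      (1 / (G : ℝ)) * ∑ g ∈ Finset.range G,
          ((∑ n, (∫ s, X.Q n (X.renewalTime g s) s ∂P))
            + (∑ m, (∫ s, X.Y m (X.renewalTime g s) s ∂P)))
        ≤ ((X.driftConst sigmaSq + C) * net.phi
            + V * (net.phi * δ + net.pen0Max - net.pen0Min)) / (ε - net.phi * δ)) ∧
    -- the time average of the objective penalty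
    X.timeAvg net.pen0 ≤ net.optValue + (X.driftConst sigmaSq + C) * net.phi / V
        + net.phi * δ * (1 + (net.pen0Max - net.optValue) / ε) ∧
    -- the average objective penalty over the first `G` renewal intervals
    (∀ G : ℕ, 0 < G →
      ∫ s, (X.renewalTime G s : ℝ) ∂P = G / net.phi ∧
      (∫ s, ∑ τ ∈ Finset.range (X.renewalTime G s), X.eval net.pen0 τ s ∂P)
          / (∫ s, (X.renewalTime G s : ℝ) ∂P)
        ≤ net.optValue + (X.driftConst sigmaSq + C) * net.phi / V
          + net.phi * δ * (1 + (net.pen0Max - net.optValue) / ε)) := by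
  have hp := net.phi_pos
  have hpen0 := net.boundedBy_pen0
  obtain ⟨S₁, _, P₁, _, X₁, -, hpen₁, hserv₁⟩ := hslack
  obtain ⟨S₂, _, P₂, _, X₂, -, hopt₂, hpen₂, hserv₂⟩ := hopt
  set B := X.driftConst sigmaSq with hB
  set e : ℕ → ℝ := fun g => ∫ s, X.frameSum net.pen0 g s ∂P with he
  set ρ := net.optValue + (B + C) * net.phi / V
    + net.phi * δ * (1 + (net.pen0Max - net.optValue) / ε) with hρ
  have hnonneg : ∀ g i, 0 ≤ ∫ s, X.queue i (X.renewalTime g s) s ∂P := fun g i => by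
    refine integral_nonneg_of_ae ?_
    filter_upwards [X.ae_queue_nonneg i] with s hs
    exact hs _
  have hstar : ∀ g c (F : N ⊕ M → ℝ), (∀ i, F i ≤ c) →
      ∑ i, (∫ s, X.queue i (X.renewalTime g s) s ∂P) * F i ≤ X.meanBacklog g * c := by
    intro g c F hF
    rw [RenewalNetwork.Run.meanBacklog, Finset.sum_mul]
    exact Finset.sum_le_sum fun i _ => mul_le_mul_of_nonneg_left (hF i) (hnonneg g i)
  have hslack' : ∀ g, X.meanLyapunov (g + 1) + V * e g ≤ X.meanLyapunov g + B + C
      + δ * X.meanBacklog g + V * δ - X.meanBacklog g * (ε / net.phi)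
      + V * (net.pen0Max / net.phi) := by
    intro g
    have h1 := X.meanLyapunov_add_penalty_le hsigma happrox X₁ g
    have h2 := hstar g _ _ (X₁.integral_frameSum_netInput_le hpen₁ hserv₁)
    have h3 := mul_le_mul_of_nonneg_left (X₁.integral_frameSum_le net.pen0_meas hpen0
      (fun o z a ha => (net.pen0_bdd o z a ha).2) 0) hV.le
    linarith
  have hopt' : ∀ g, X.meanLyapunov (g + 1) + V * e g ≤ X.meanLyapunov g + B + C
      + δ * X.meanBacklog g + V * δ + V * (net.optValue / net.phi) := by
    intro g
    have h1 := X.meanLyapunov_add_penalty_le hsigma happrox X₂ g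
    have h2 := hstar g _ _ (X₂.integral_frameSum_netInput_le (c := 0) (by simpa using hpen₂) hserv₂)
    have h3 : ∫ s, X₂.frameSum net.pen0 0 s ∂P₂ = net.optValue / net.phi := by
      rw [← hopt₂, RenewalNetwork.Run.frameRatio, X₂.integral_frameLength]
      field_simp
    rw [h3] at h1
    rw [zero_div, neg_zero, mul_zero] at h2
    linarith
  -- a convex combination of the two comparisons cancels the backlog
  have hcomb : ∀ g, X.meanLyapunov (g + 1) + V * e g ≤ X.meanLyapunov g + V * (ρ / net.phi) := by
    intro g
    -- This weight solves `p * (ε/φ) = δ`: the negative backlog term of the slack comparison then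
    -- exactly offsets the error `δ` times the backlog. The hypothesis `φδ < ε` makes it a valid
    -- convex weight.
    set p := net.phi * δ / ε with hpdef
    have hp0 : 0 ≤ p := by positivity
    have hp1 : 0 ≤ 1 - p := by rw [sub_nonneg, hpdef, div_le_one hε]; exact hεδ.le
    have h1 := mul_le_mul_of_nonneg_left (hslack' g) hp0
    have h2 := mul_le_mul_of_nonneg_left (hopt' g) hp1
    have h3 : p * (X.meanBacklog g * (ε / net.phi)) = δ * X.meanBacklog g := by
      rw [hpdef]; field_simp
    have h4 : V * (ρ / net.phi) = B + C + V * δ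
        + (p * (V * (net.pen0Max / net.phi)) + (1 - p) * (V * (net.optValue / net.phi))) := by
      rw [hρ, hpdef]; field_simp; ring
    linarith
  have hsum : ∀ G : ℕ, ∑ g ∈ Finset.range G, e g ≤ G * (ρ / net.phi) := by
    intro G
    have h := mul_sum_le_of_drift X.meanLyapunov_zero X.meanLyapunov_nonneg hcomb G
    rw [mul_left_comm] at h
    exact le_of_mul_le_mul_left h hV
  have hmin : ∀ g, net.pen0Min / net.phi ≤ e g :=
    X.le_integral_frameSum net.pen0_meas hpen0 fun o z a ha => (net.pen0_bdd o z a ha).1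
  have hback : ∀ G : ℕ, (ε - net.phi * δ) * ∑ g ∈ Finset.range G, X.meanBacklog g
      ≤ G * ((B + C) * net.phi + V * (net.phi * δ + net.pen0Max - net.pen0Min)) := by
    intro G
    -- Scaling by `φ` turns `ε/φ - δ` into `ε - φδ` and the interval bounds `x_0^min/φ`, `x_0^max/φ`
    -- into the constants of the claim.
    refine mul_sum_le_of_drift (L := fun g => net.phi * X.meanLyapunov g) ?_ ?_ ?_ G
    · rw [X.meanLyapunov_zero, mul_zero]
    · exact fun g => mul_nonneg hp.le (X.meanLyapunov_nonneg g)
    · intro g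
      have h1 := mul_le_mul_of_nonneg_left (hslack' g) hp.le
      have h2 := mul_le_mul_of_nonneg_left (hmin g) (mul_nonneg hp.le hV.le)
      have h3 : net.phi * (X.meanBacklog g * (ε / net.phi)) = ε * X.meanBacklog g := by
        field_simp
      have h4 : net.phi * (V * (net.pen0Max / net.phi)) = V * net.pen0Max := by field_simp
      have h5 : net.phi * V * (net.pen0Min / net.phi) = V * net.pen0Min := by field_simp
      linarith
  have hgap : 0 < ε - net.phi * δ := sub_pos.2 hεδ
  have hbackD : ∀ G : ℕ, ∑ g ∈ Finset.range G, X.meanBacklog g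
      ≤ G * (((B + C) * net.phi + V * (net.phi * δ + net.pen0Max - net.pen0Min))
        / (ε - net.phi * δ)) := by
    intro G
    rw [← mul_div_assoc, le_div_iff₀' hgap]
    exact hback G
  -- The penalty of an interval is at least `x_0^min/φ` in mean, so `hcomb` lets the Lyapunov
  -- function grow at most linearly. The absolute value supplies the nonnegative rate that
  -- `timeAvg_pen_le` requires.
  have hlyap : ∀ G : ℕ, X.meanLyapunov G
      ≤ G * |V * (ρ / net.phi) - V * (net.pen0Min / net.phi)| := by
    intro G
    induction G with
    | zero => simp [X.meanLyapunov_zero]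
    | succ G ih =>
      have h1 := mul_le_mul_of_nonneg_left (hmin G) hV.le
      have h2 := le_abs_self (V * (ρ / net.phi) - V * (net.pen0Min / net.phi))
      push_cast
      linarith [hcomb G]
  refine ⟨?_, fun n => X.avgBacklog_queue_lt_top hbackD (Sum.inl n),
    fun m => X.avgBacklog_queue_lt_top hbackD (Sum.inr m),
    fun m => X.timeAvg_pen_le (abs_nonneg _) hlyap m,
    fun g n => X.integrable_queue_renewal (Sum.inl n) g,
    fun g m => X.integrable_queue_renewal (Sum.inr m) g, fun G hG => ?_,
    X.timeAvg_le_of_frame_bound net.pen0_meas hpen0 hsum,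
    fun G hG => ⟨X.integral_renewalTime G, ?_⟩⟩
  · rw [hB, X.driftConst_eq]
    apply le_of_eq
    field_simp
  · have hG' : (0 : ℝ) < G := Nat.cast_pos.2 hG
    rw [one_div_mul_eq_div, div_le_iff₀' hG']
    refine le_trans (le_of_eq (Finset.sum_congr rfl fun g _ => ?_)) (hbackD G)
    exact (Fintype.sum_sum_type fun i => ∫ s, X.queue i (X.renewalTime g s) s ∂P).symm
  · have hG' : (0 : ℝ) < G := Nat.cast_pos.2 hG
    rw [X.integral_sum_renewalTime net.pen0_meas hpen0, X.integral_renewalTime,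
      div_le_iff₀ (div_pos hG' hp)]
    refine (hsum G).trans_eq ?_
    ring
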